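/- Let $G$ be a finitely generated group. Definitions. A map $\phi\colon G\to\mathbb R$ is a homogeneous quasimorphism if $\phi(g^n)=n\phi(g)$ for all $g\in G$, $n\in\mathbb Z$, and $\sup_{g,h}|\phi(g)+\phi(h)-\phi(gh)|<\infty$; this supremum is the defect $D(\phi)$. Let $Q^h(G)$ be the real vector space of homogeneous quasimorphisms on $G$, topologised as the disjoint union over $x\in[0,\infty)$ of the slices $\{\phi\in Q^h(G) : D(\phi)=x\}$, each with the subspace topology from $\mathbb R^G$ with the product topology. For a finite generating set $S$ of $G$, $A\subseteq G$ and $n\in\mathbb N$, the Rips complex $R_S(A,n)$ has vertex set $A$, and finitely many distinct elements of $A$ span a simplex iff they are a single vertex or have diameter less than $n$ in the word metric $d_S(g,h)=|g^{-1}h|_S$. The set $A$ is approximately connected if $R_S(A,N)$ is connected (in particular non-empty) for some finite generating set $S$ and some $N\in\mathbb N$. The set $A$ is an approximate group if $A\cdot A\subseteq A\cdot X$ for some finite $X\subseteq G$; it is approximately finitely generated if it is an approximate group and is approximately connected. Put $$\mathrm{Aker}\,\phi=\{g\in G : |\phi(g)|\le 2D(\phi)\},\qquad Q\Sigma(G)=\big\{\phi\in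 Q^h(G) : \{g\in G : \phi(g)>0\}\text{ is approximately connected}\big\}.$$ The Novikov ring $\widehat{\mathbb ZG}^\phi$ consists of the formal sums $\sum_{g\in G}\lambda_g g$ with $\lambda_g\in\mathbb Z$ such that for every $x\in\mathbb R$ the set $\{g\in G : \phi(g)<x,\ \lambda_g\ne 0\}$ is finite; it is a right $\mathbb ZG$-module by multiplication, and $\mathrm H_1(G;\widehat{\mathbb ZG}^\phi)=\mathrm{Tor}_1^{\mathbb ZG}(\widehat{\mathbb ZG}^\phi,\mathbb Z)$ is the first homology of $G$ with coefficients in this module. Theorem. 1. $Q\Sigma(G)$ is an open subset of $Q^h(G)$. 2. For every $\phi\in Q^h(G)$ with $D(\phi)\neq0$, the approximate kernel $\mathrm{Aker}\,\phi$ is approximately finitely generated if and only if $\{\phi,-\phi\}\subseteq Q\Sigma(G)$. 3. For every non-zero $\phi\in Q^h(G)$ (in particular whenever $D(\phi)\ne0$) the following are equivalent: (a) $\phi\in Q\Sigma(G)$; (b) there is an open neighbourhood $U$ of $\phi$ in $Q^h(G)$ such that $\mathrm H_1(G;\widehat{\mathbb ZG}^\psi)=0$ for every $\psi\in U$; (c)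 $\mathrm H_1(G;\widehat{\mathbb ZG}^\phi)=0$. -/

import Mathlib

open scoped Topology Pointwise

noncomputable section

namespace QuasiBNS

universe u

/-! ### Word metrics, Rips complexes, approximate connectivity -/

/-- The word length of `g` with respect to `S`: the least length of a word in the letters
`S ∪ S⁻¹` representing `g` (such a word exists as soon as `S` generates the group). -/
def wordLength {G : Type u} [Group G] (S : Finset G) (g : G) : ℕ :=
  sInf {n : ℕ | ∃ l : List G, (∀ s ∈ l, s ∈ S ∨ s⁻¹ ∈ S) ∧ l.prod = g ∧ l.length = n}

/-- The left-invariant word metric with respect to `S`. -/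
def wordDist {G : Type u} [Group G] (S : Finset G) (g h : G) : ℕ :=
  wordLength S (g⁻¹ * h)

/-- The Rips complex of `A` with parameter `n`: the vertices are the elements of `A`, and finitely
many pairwise distinct elements of `A` span a simplex iff they have diameter less than `n`.
Every vertex belongs to the complex, whatever `n` is. -/
def ripsComplex {G : Type u} [Group G] (S : Finset G) (A : Set G) (n : ℕ) :
    AbstractSimplicialComplex A where
  faces := {σ | σ.Nonempty ∧
    ((∃ v, σ = {v}) ∨ ∀ x ∈ σ, ∀ y ∈ σ, wordDist S (x : G) (y : G) < n)}
  isRelLowerSet_faces := by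
    rintro σ ⟨hσ, h⟩
    refine ⟨hσ, fun τ hτσ hτ => ⟨hτ, ?_⟩⟩
    rcases h with ⟨v, rfl⟩ | h
    · left
      exact ⟨v, (Finset.subset_singleton_iff.mp hτσ).resolve_left hτ.ne_empty⟩
    · exact Or.inr fun x hx y hy => h x (hτσ hx) y (hτσ hy)
  singleton_mem := fun v => ⟨Finset.singleton_nonempty v, Or.inl ⟨v, rfl⟩⟩

open Classical in
/-- The graph formed by the vertices and the edges of a simplicial complex. -/
def oneSkeleton {V : Type u} (K : AbstractSimplicialComplex V) : SimpleGraph V where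
  Adj x y := x ≠ y ∧ ({x, y} : Finset V) ∈ K.faces
  symm := ⟨fun _ _ h => ⟨h.1.symm, by simpa [Finset.pair_comm] using h.2⟩⟩
  loopless := ⟨fun _ h => h.1 rfl⟩

/-- A simplicial complex is connected iff its 1-skeleton is; connected spaces are non-empty. -/
def ComplexConnected {V : Type u} (K : AbstractSimplicialComplex V) : Prop :=
  (oneSkeleton K).Connected

/-- A subset `A` of a group is approximately connected if for some finite generating set and some
parameter its Rips complex is connected. In particular, `A` is non-empty. -/
def ApproxConnected {G : Type u} [Group G] (A : Set G) : Prop :=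
  ∃ S : Finset G, Subgroup.closure (S : Set G) = ⊤ ∧
    ∃ N : ℕ, ComplexConnected (ripsComplex S A N)

/-- `A` is an approximate group: `A · A ⊆ A · X` for some finite set `X`. -/
def IsApproxGroup {G : Type u} [Group G] (A : Set G) : Prop :=
  ∃ X : Finset G, A * A ⊆ A * (X : Set G)

/-- `A` is an approximately finitely generated approximate group. -/
def ApproxFinGen {G : Type u} [Group G] (A : Set G) : Prop :=
  IsApproxGroup A ∧ ApproxConnected A

/-! ### Homogeneous quasimorphisms -/

/-- `φ` is a quasimorphism. -/
def IsQuasimorphism {G : Type u} [Group G] (φ : G → ℝ) : Prop :=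
  ∃ C : ℝ, 0 < C ∧ ∀ g h : G, |φ g + φ h - φ (g * h)| ≤ C

/-- `φ` is homogeneous. -/
def IsHomogeneous {G : Type u} [Group G] (φ : G → ℝ) : Prop :=
  ∀ (g : G) (n : ℤ), φ (g ^ n) = n * φ g

/-- The real vector space `Q^h(G)` of homogeneous quasimorphisms on `G`. -/
def Qh (G : Type u) [Group G] : Submodule ℝ (G → ℝ) where
  carrier := {φ | IsQuasimorphism φ ∧ IsHomogeneous φ}
  zero_mem' := ⟨⟨1, one_pos, fun g h => by simp⟩, fun g n => by simp⟩
  add_mem' := by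
    rintro φ ψ ⟨⟨C, hC, hφ⟩, hφ'⟩ ⟨⟨D, hD, hψ⟩, hψ'⟩
    refine ⟨⟨C + D, add_pos hC hD, fun g h => ?_⟩, fun g n => ?_⟩
    · have h1 := abs_le.mp (hφ g h)
      have h2 := abs_le.mp (hψ g h)
      simp only [Pi.add_apply]
      exact abs_le.mpr ⟨by linarith [h1.1, h2.1], by linarith [h1.2, h2.2]⟩
    · simp only [Pi.add_apply, hφ' g n, hψ' g n]
      ring
  smul_mem' := by
    rintro c φ ⟨⟨C, hC, hφ⟩, hφ'⟩
    refine ⟨⟨|c| * C + 1, by positivity, fun g h => ?_⟩, fun g n => ?_⟩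
    · have h1 : |c| * |φ g + φ h - φ (g * h)| ≤ |c| * C :=
        mul_le_mul_of_nonneg_left (hφ g h) (abs_nonneg c)
      rw [← abs_mul] at h1
      simp only [Pi.smul_apply, smul_eq_mul]
      rw [show c * φ g + c * φ h - c * φ (g * h) = c * (φ g + φ h - φ (g * h)) by ring]
      linarith
    · simp only [Pi.smul_apply, smul_eq_mul, hφ' g n]
      ring

/-- The defect of a quasimorphism `φ`: the least `C` with `|φ(g) + φ(h) - φ(gh)| ≤ C` for all
`g, h` (it is `0` exactly when `φ` is a homomorphism). -/
def defect {G : Type u} [Group G] (φ : G → ℝ) : ℝ :=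
  sInf {C : ℝ | ∀ g h : G, |φ g + φ h - φ (g * h)| ≤ C}

/-- The topology on `Q^h(G)` as the disjoint union, over `x`, of the slices of defect `x`, each of
which carries the subspace topology from `ℝ^G` with the product topology. This is finer than the
subspace topology that `Q^h(G)` itself inherits from `ℝ^G`. -/
@[reducible]
def sliceTopology (G : Type u) [Group G] : TopologicalSpace (Qh G) :=
  ⨆ x : ℝ, TopologicalSpace.coinduced
    (fun φ : {φ : Qh G // defect (φ : G → ℝ) = x} => φ.1)
    (TopologicalSpace.induced
      (fun φ : {φ : Qh G // defect (φ : G → ℝ) = x} => ((φ.1 : Qh G) : G → ℝ))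
      Pi.topologicalSpace)

/-- The approximate kernel of `φ`. -/
def Aker {G : Type u} [Group G] (φ : Qh G) : Set G :=
  {g | |(φ : G → ℝ) g| ≤ 2 * defect (φ : G → ℝ)}

/-- The quasi-BNS invariant of `G`. -/
def QSigma (G : Type u) [Group G] : Set (Qh G) :=
  {φ | ApproxConnected {g : G | 0 < (φ : G → ℝ) g}}

/-! ### Novikov homology -/

/-- The formal sums `∑ a_g g` with integer coefficients such that for every real `x` only finitely
many `g` with `φ(g) < x` have `a_g ≠ 0`: the abelian group underlying the Novikov ring of `φ`. -/
def novikov {G : Type u} [Group G] (φ : Qh G) : AddSubgroup (G → ℤ) where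
  carrier := {a | ∀ x : ℝ, {g : G | (φ : G → ℝ) g < x ∧ a g ≠ 0}.Finite}
  zero_mem' := fun x => by simp
  add_mem' := by
    intro a b ha hb x
    refine ((ha x).union (hb x)).subset ?_
    rintro g ⟨hg, hab⟩
    by_cases h : a g = 0
    · right
      refine ⟨hg, fun h' => hab ?_⟩
      simp [h, h']
    · exact Or.inl ⟨hg, h⟩
  neg_mem' := by
    intro a ha x
    simpa using ha x

theorem novikov_translate_mem {G : Type u} [Group G] (φ : Qh G) (g : G) {a : G → ℤ}
    (ha : a ∈ novikov φ) : (fun k => a (k * g)) ∈ novikov φ := by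
  obtain ⟨C, -, hC⟩ := φ.2.1
  intro x
  refine ((ha (x + (φ : G → ℝ) g + C)).preimage
    ((mul_left_injective g).injOn (s := _))).subset ?_
  rintro k ⟨hk, hak⟩
  refine ⟨?_, hak⟩
  have h1 := (abs_le.mp (hC k g)).1
  linarith

/-- The right `ℤG`-module structure of the Novikov ring, given by right multiplication and written
as a left action in the usual way, `g • a = a * g⁻¹`; the coefficient of `k` in `a * g⁻¹` is the
coefficient of `k * g` in `a`. The scalars `ℤ` are moved to the universe of `G`. -/
def novikovRep {G : Type u} [Group G] (φ : Qh G) :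
    Representation (ULift.{u} ℤ) G (novikov φ) where
  toFun g :=
    { toFun := fun a => ⟨fun k => (a : G → ℤ) (k * g), novikov_translate_mem φ g a.2⟩
      map_add' := fun _ _ => rfl
      map_smul' := fun _ _ => rfl }
  map_one' := by
    ext a k
    simp
  map_mul' g h := by
    ext a k
    simp [mul_assoc]

/-- The first Novikov homology `H₁(G; ZG^φ)`: the first homology of `G` with coefficients in the
Novikov ring, that is, `Tor₁` over `ℤG` of the Novikov ring (as a right module) and `ℤ`. -/
def novikovH1 {G : Type u} [Group G] (φ : Qh G) : ModuleCat.{u} (ULift.{u} ℤ) :=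
  groupHomology (Rep.of (novikovRep φ)) 1

end QuasiBNS

end

open scoped Topology Pointwise

noncomputable section

namespace QuasiBNS

universe u

variable {G : Type u} [Group G]

/-! ### Paths in groups -/

/-! Write D for the defect of φ and call φ(g) the height of g. All three statements go through one
finite criterion, `Pushes` at height D: some T with φ(T) > D is joined to sT inside {φ > D} for
every generator s. As φ(uw) ≥ φ(u) + φ(w) - D, left translation by u carries such a path above
height φ(u), with a uniform gain since only finitely many points occur. Replacing the edges of a
path by these translates, again and again, lifts the path as high as desired, and the rays x, xT,
xT², ... join it to its original ends; so {φ > 0} is approximately connected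
(`mem_QSigma_of_pushes`). Conversely, translates of {φ > 0} yield the criterion at every height
(`exists_pushes`). The criterion consists of finitely many strict inequalities φ(g) > D, hence is
open on a slice, where D is constant.

If D ≠ 0, some t has 0 < φ(t) ≤ D (`exists_pos_le_defect`), so powers of t move elements of bounded
height into the approximate kernel. Connectivity of the kernel, translated to great height, gives
that of {φ > 0}; the kernel does not see the sign of φ. Conversely, connectivity of {φ > 0} joins
points of the kernel by paths bounded below, pushing for -φ lowers their peaks to a uniform bound
(`exists_linked_bounded`), and the resulting band is moved into the kernel.

For Novikov homology, pushing by T is a chain homotopy from the identity to an operator P that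
raises supports, so 1 - P is onto and cycles bound (`Pushes.novikovH1_subsingleton`). Conversely, if
T = t^m and sT lay in different components of {φ > D}, the indicator of a component would define a
cocycle detecting the cycle formed by an edge and two infinite rays
(`mem_iff_of_novikovH1_subsingleton`). -/

/-- `x` and `y` are joined by a path inside `A` whose steps are right multiplications by elements
of `B`. -/
def Linked (B A : Set G) (x y : G) : Prop :=
  x ∈ A ∧ Relation.ReflTransGen (fun u v => u⁻¹ * v ∈ B ∧ v ∈ A) x y

namespace Linked

variable {A A' B B' : Set G} {x y z : G}

theorem refl (hx : x ∈ A) : Linked B A x x := ⟨hx, .refl⟩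

theorem left_mem (h : Linked B A x y) : x ∈ A := h.1

theorem right_mem (h : Linked B A x y) : y ∈ A := by
  obtain ⟨hx, h⟩ := h
  induction h with
  | refl => exact hx
  | tail _ h _ => exact h.2

theorem trans (h : Linked B A x y) (h' : Linked B A y z) : Linked B A x z :=
  ⟨h.1, h.2.trans h'.2⟩

theorem step (hx : x ∈ A) (hy : y ∈ A) (h : x⁻¹ * y ∈ B) : Linked B A x y :=
  ⟨hx, .single ⟨h, hy⟩⟩

theorem step_mul {b : G} (hb : b ∈ B) (hx : x ∈ A) (hy : x * b ∈ A) : Linked B A x (x * b) :=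
  .step hx hy (by simpa using hb)

/-- Induction on paths, one edge at a time. -/
theorem map {f : G → G} (hx : f x ∈ A')
    (hf : ∀ u ∈ A, ∀ v ∈ A, u⁻¹ * v ∈ B → Linked B' A' (f u) (f v))
    (h : Linked B A x y) : Linked B' A' (f x) (f y) := by
  obtain ⟨hxA, h⟩ := h
  have key : Linked B' A' (f x) (f y) ∧ y ∈ A := by
    induction h with
    | refl => exact ⟨refl hx, hxA⟩
    | tail _ h ih => exact ⟨ih.1.trans (hf _ ih.2 _ h.2 h.1), h.2⟩
  exact key.1

theorem mono (hB : B ⊆ B') (hA : A ⊆ A') (h : Linked B A x y) : Linked B' A' x y :=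
  h.map (f := id) (hA h.1) fun _ hu _ hv huv => .step (hA hu) (hA hv) (hB huv)

theorem mono_right (hA : A ⊆ A') (h : Linked B A x y) : Linked B A' x y :=
  h.mono subset_rfl hA

theorem translate (g : G) (hA : ∀ a ∈ A, g * a ∈ A') (h : Linked B A x y) :
    Linked B A' (g * x) (g * y) :=
  h.map (f := fun a => g * a) (hA _ h.1) fun u hu v hv huv =>
    .step (hA _ hu) (hA _ hv) (by simpa [mul_assoc] using huv)

theorem symm (hB : ∀ b ∈ B, b⁻¹ ∈ B) (h : Linked B A x y) : Linked B A y x := by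
  obtain ⟨hx, h⟩ := h
  have key : Linked B A y x ∧ y ∈ A := by
    induction h with
    | refl => exact ⟨refl hx, hx⟩
    | tail _ h ih =>
      exact ⟨(step h.2 ih.2 (by simpa using hB _ h.1)).trans ih.1, h.2⟩
  exact key.1

theorem exists_finset (h : Linked B A x y) : ∃ F : Finset G, (F : Set G) ⊆ A ∧
    Linked B F x y := by
  classical
  obtain ⟨hx, h⟩ := h
  induction h with
  | refl => exact ⟨{x}, by simpa using hx, refl (by simp)⟩
  | @tail b c _ h ih =>
    obtain ⟨F, hF, hl⟩ := ih
    have hm := hl.mono_right (A' := ((insert c F : Finset G) : Set G)) (by simp)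
    refine ⟨insert c F, ?_, hm.trans (.step hm.right_mem (by simp) h.1)⟩
    rw [Finset.coe_insert]
    exact Set.insert_subset h.2 hF

end Linked

theorem linked_univ {S : Set G} (hS : Subgroup.closure S = ⊤) (hS' : ∀ s ∈ S, s⁻¹ ∈ S)
    (x y : G) : Linked S Set.univ x y := by
  have key : ∀ g : G, Linked S Set.univ 1 g := fun g => by
    have hg : g ∈ Subgroup.closure S := hS ▸ Subgroup.mem_top g
    induction hg using Subgroup.closure_induction with
    | mem s hs => exact .step trivial trivial (by simpa using hs)
    | one => exact .refl trivial
    | mul a b _ _ ha hb =>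
      exact ha.trans (by simpa using hb.translate a (A' := Set.univ) fun _ _ => trivial)
    | inv a _ ha =>
      simpa using (ha.translate a⁻¹ (A' := Set.univ) fun _ _ => trivial).symm hS'
  simpa using (key (x⁻¹ * y)).translate x (A' := Set.univ) fun _ _ => trivial

/-- `S` is a finite symmetric generating set. -/
structure IsSymmGen (S : Finset G) : Prop where
  closure_eq : Subgroup.closure (S : Set G) = ⊤
  inv_mem : ∀ s ∈ (S : Set G), s⁻¹ ∈ (S : Set G)

theorem exists_isSymmGen (hG : Group.FG G) : ∃ S : Finset G, IsSymmGen S := by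
  classical
  obtain ⟨S, hS⟩ := Group.fg_def.1 hG
  refine ⟨S ∪ S⁻¹, ?_, ?_⟩
  · rw [eq_top_iff, ← hS]
    exact Subgroup.closure_mono (by simp)
  · intro s hs
    simp only [Finset.coe_union, Finset.coe_inv, Set.mem_union, Set.mem_inv, Finset.mem_coe,
      inv_inv] at hs ⊢
    exact hs.symm

/-! ### Approximate connectivity in terms of paths -/

theorem finite_wordLength_lt {S : Finset G} (hS : Subgroup.closure (S : Set G) = ⊤) (N : ℕ) :
    {g : G | wordLength S g < N}.Finite := by
  classical
  set B : Set G := {s | s ∈ S ∨ s⁻¹ ∈ S} with hB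
  have hBfin : B.Finite := by
    refine (S.finite_toSet.union (S⁻¹).finite_toSet).subset fun s hs => ?_
    simpa [hB] using hs
  have hword : ∀ g : G, ∃ l : List G, (∀ s ∈ l, s ∈ S ∨ s⁻¹ ∈ S) ∧ l.prod = g := fun g => by
    have hg : g ∈ Subgroup.closure (S : Set G) := hS ▸ Subgroup.mem_top g
    rw [← Subgroup.mem_toSubmonoid, Subgroup.closure_toSubmonoid] at hg
    obtain ⟨l, hl, h⟩ := Submonoid.exists_list_of_mem_closure hg
    exact ⟨l, by simpa using hl, h⟩
  have hlist : {l : List G | (∀ s ∈ l, s ∈ B) ∧ l.length < N}.Finite := by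
    have : Finite B := hBfin
    have h1 : {l : List B | l.length < N}.Finite := List.finite_length_lt B N
    refine (h1.image (List.map Subtype.val)).subset ?_
    rintro l ⟨hl, hlen⟩
    exact ⟨l.attachWith (· ∈ B) hl, by simpa using hlen, by simp⟩
  refine (hlist.image List.prod).subset fun g hg => ?_
  obtain ⟨l, hl, hlg⟩ := hword g
  have hne : {n : ℕ | ∃ l : List G, (∀ s ∈ l, s ∈ S ∨ s⁻¹ ∈ S) ∧ l.prod = g ∧
    l.length = n}.Nonempty := ⟨_, l, hl, hlg, rfl⟩
  obtain ⟨l', h1, h2, h3⟩ := Nat.sInf_mem hne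
  exact ⟨l', ⟨h1, h3 ▸ hg⟩, h2⟩

theorem wordLength_one (S : Finset G) : wordLength S 1 = 0 :=
  Nat.sInf_eq_zero.2 (.inl ⟨[], by simp⟩)

theorem ApproxConnected.exists_linked {A : Set G} (hA : ApproxConnected A) :
    A.Nonempty ∧ ∃ B : Set G, B.Finite ∧ ∀ x ∈ A, ∀ y ∈ A, Linked B A x y := by
  classical
  obtain ⟨S, hS, N, hconn⟩ := hA
  refine ⟨Set.nonempty_coe_sort.1 hconn.nonempty, _, finite_wordLength_lt hS N, ?_⟩
  intro x hx y hy
  obtain ⟨p⟩ := hconn.preconnected ⟨x, hx⟩ ⟨y, hy⟩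
  have key : ∀ {a b : A}, (oneSkeleton (ripsComplex S A N)).Walk a b →
      Linked {g : G | wordLength S g < N} A a b := by
    intro a b p
    induction p with
    | nil => exact .refl (Subtype.mem _)
    | @cons a b c h _ ih =>
      refine Linked.trans (.step a.2 b.2 ?_) ih
      obtain ⟨hne, -, h | h⟩ := h
      · obtain ⟨v, hv⟩ := h
        have ha : a ∈ ({v} : Finset A) := hv ▸ by simp
        have hb : b ∈ ({v} : Finset A) := hv ▸ by simp
        rw [Finset.mem_singleton] at ha hb
        exact absurd (ha.trans hb.symm) hne
      · exact h a (by simp) b (by simp)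
  exact key p

theorem approxConnected_of_linked (hG : Group.FG G) {A B : Set G} (hB : B.Finite)
    (hne : A.Nonempty) (h : ∀ x ∈ A, ∀ y ∈ A, Linked B A x y) : ApproxConnected A := by
  classical
  obtain ⟨S, hS⟩ := Group.fg_def.1 hG
  -- The diameter condition tests both orders of each pair, so inverses are bounded too; it is
  -- strict, whence the parameter M + 1.
  obtain ⟨M, hM⟩ : ∃ M, ∀ b ∈ B, wordLength S b ≤ M ∧ wordLength S b⁻¹ ≤ M := by
    obtain ⟨M, hM⟩ := (hB.image fun b => wordLength S b + wordLength S b⁻¹).bddAbove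
    exact ⟨M, fun b hb => by have := hM ⟨b, hb, rfl⟩; dsimp at this; omega⟩
  refine ⟨S, hS, M + 1, ?_⟩
  have : Nonempty A := hne.to_subtype
  refine SimpleGraph.Connected.mk fun x y => ?_
  obtain ⟨-, hxy⟩ := h x x.2 y y.2
  have key : ∀ {b : G}, Relation.ReflTransGen (fun u v => u⁻¹ * v ∈ B ∧ v ∈ A) (x : G) b →
      ∃ hb : b ∈ A, (oneSkeleton (ripsComplex S A (M + 1))).Reachable x ⟨b, hb⟩ := by
    intro b hb
    induction hb with
    | refl => exact ⟨x.2, .rfl⟩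
    | @tail b c _ hbc ih =>
      obtain ⟨hb, ih⟩ := ih
      refine ⟨hbc.2, ih.trans ?_⟩
      by_cases hne : b = c
      · subst hne; exact .rfl
      refine SimpleGraph.Adj.reachable ⟨by simpa using hne, by simp, .inr ?_⟩
      have h1 := hM _ hbc.1
      simp only [mul_inv_rev, inv_inv] at h1
      intro u hu v hv
      simp only [Finset.mem_insert, Finset.mem_singleton] at hu hv
      rcases hu with rfl | rfl <;> rcases hv with rfl | rfl <;>
        simp only [wordDist, inv_mul_cancel, wordLength_one] <;> omega
  exact (key hxy).2

/-! ### Homogeneous quasimorphisms -/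

namespace Qh

variable (φ : Qh G)

theorem abs_le_defect (g h : G) : |φ.1 g + φ.1 h - φ.1 (g * h)| ≤ defect φ.1 := by
  obtain ⟨C, -, hC⟩ := φ.2.1
  exact le_csInf ⟨C, hC⟩ fun c hc => hc g h

theorem defect_nonneg : 0 ≤ defect φ.1 := (abs_nonneg _).trans (abs_le_defect φ 1 1)

theorem le_map_mul (g h : G) : φ.1 g + φ.1 h - defect φ.1 ≤ φ.1 (g * h) := by
  linarith [(abs_le.1 (abs_le_defect φ g h)).2]

theorem map_mul_le (g h : G) : φ.1 (g * h) ≤ φ.1 g + φ.1 h + defect φ.1 := by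
  linarith [(abs_le.1 (abs_le_defect φ g h)).1]

theorem map_zpow (g : G) (n : ℤ) : φ.1 (g ^ n) = n * φ.1 g := φ.2.2 g n

theorem map_pow (g : G) (n : ℕ) : φ.1 (g ^ n) = n * φ.1 g := by
  simpa using map_zpow φ g n

theorem map_inv (g : G) : φ.1 g⁻¹ = -φ.1 g := by
  simpa using map_zpow φ g (-1)

theorem map_one : φ.1 1 = 0 := by
  simpa using map_zpow φ 1 0

theorem eq_of_bounded_nsmul {a b C : ℝ} (h : ∀ n : ℕ, |n * a - n * b| ≤ C) : a = b := by
  by_contra hne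
  obtain ⟨n, hn⟩ := exists_nat_gt (C / |a - b|)
  have hpos : 0 < |a - b| := abs_pos.2 (sub_ne_zero.2 hne)
  rw [div_lt_iff₀ hpos] at hn
  have := h n
  rw [← mul_sub, abs_mul, Nat.abs_cast] at this
  linarith

/-- The n-th power of the conjugate is g hⁿ g⁻¹, whose height differs from that of hⁿ by at most 2D
for every n; dividing by n kills the error. -/
theorem map_conj (g h : G) : φ.1 (g * h * g⁻¹) = φ.1 h := by
  refine eq_of_bounded_nsmul (C := 2 * defect φ.1) fun n => ?_
  rw [← map_pow, ← map_pow, conj_pow]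
  have h1 := le_map_mul φ (g * h ^ n) g⁻¹
  have h2 := map_mul_le φ (g * h ^ n) g⁻¹
  have h3 := le_map_mul φ g (h ^ n)
  have h4 := map_mul_le φ g (h ^ n)
  rw [map_inv] at h1 h2
  exact abs_le.2 ⟨by linarith, by linarith⟩

theorem defect_neg : defect (-φ).1 = defect φ.1 := by
  have : ∀ g h : G, |(-φ).1 g + (-φ).1 h - (-φ).1 (g * h)| = |φ.1 g + φ.1 h - φ.1 (g * h)| := by
    intro g h
    rw [← abs_neg]
    congr 1
    change -(-φ.1 g + -φ.1 h - -φ.1 (g * h)) = _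
    ring
  simp only [defect, this]

theorem neg_val_apply (g : G) : (-φ).1 g = -φ.1 g := rfl

theorem Aker_neg : Aker (-φ) = Aker φ := by
  ext g
  change |(-φ).1 g| ≤ 2 * defect (-φ).1 ↔ |φ.1 g| ≤ 2 * defect φ.1
  rw [defect_neg, neg_val_apply, abs_neg]

variable {φ}

theorem exists_pos (h : φ ≠ 0) : ∃ t, 0 < φ.1 t := by
  obtain ⟨g, hg⟩ : ∃ g, φ.1 g ≠ 0 := by
    by_contra! h'
    exact h (Subtype.ext (funext h'))
  rcases hg.lt_or_gt with hg | hg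
  · exact ⟨g⁻¹, by rw [map_inv]; linarith⟩
  · exact ⟨g, hg⟩

theorem exists_gt {t : G} (ht : 0 < φ.1 t) (K : ℝ) : ∃ n : ℕ, K < φ.1 (t ^ n) := by
  obtain ⟨n, hn⟩ := exists_nat_gt (K / φ.1 t)
  exact ⟨n, by rwa [map_pow, ← div_lt_iff₀ ht]⟩

/-- A homogeneous quasimorphism that is not a homomorphism takes arbitrarily small values, relative
to its defect. -/
theorem exists_pos_le_defect (hD : defect φ.1 ≠ 0) : ∃ t, 0 < φ.1 t ∧ φ.1 t ≤ defect φ.1 := by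
  by_contra! hno
  have hzero : ∀ g, |φ.1 g| ≤ defect φ.1 → φ.1 g = 0 := fun g hg => by
    rcases lt_trichotomy (φ.1 g) 0 with h | h | h
    · have := hno g⁻¹ (by rw [map_inv]; linarith)
      rw [map_inv] at this
      linarith [(abs_le.1 hg).1]
    · exact h
    · linarith [hno g h, (abs_le.1 hg).2]
  -- A commutator is the product of a conjugate of b with b⁻¹, whose heights cancel, so its height
  -- is at most D in absolute value and therefore 0. Products of elements of height 0 stay at 0 for
  -- the same reason.
  have hcomm : ∀ g ∈ commutator G, φ.1 g = 0 := by
    intro g hg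
    rw [commutator_eq_closure] at hg
    induction hg using Subgroup.closure_induction with
    | mem x hx =>
      obtain ⟨a, b, rfl⟩ := hx
      refine hzero _ ?_
      rw [commutatorElement_def]
      have h1 := abs_le_defect φ (a * b * a⁻¹) b⁻¹
      rw [map_conj, map_inv, add_neg_cancel, zero_sub, abs_neg] at h1
      exact h1
    | one => exact map_one φ
    | mul x y _ _ hx hy =>
      refine hzero _ ?_
      have h1 := abs_le_defect φ x y
      rwa [hx, hy, add_zero, zero_sub, abs_neg] at h1
    | inv x _ hx => rw [map_inv, hx, neg_zero]
  -- (gh)ⁿ and gⁿhⁿ differ by an element of the commutator subgroup, which has height 0, so n times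
  -- the failure of additivity is bounded.
  have hadd : ∀ g h, φ.1 (g * h) = φ.1 g + φ.1 h := by
    intro g h
    refine eq_of_bounded_nsmul (C := 2 * defect φ.1) fun n => ?_
    have hk : φ.1 ((g ^ n * h ^ n)⁻¹ * (g * h) ^ n) = 0 := by
      refine hcomm _ ?_
      rw [← Abelianization.ker_of, MonoidHom.mem_ker]
      simp [mul_pow]
    have e : (g * h) ^ n = (g ^ n * h ^ n) * ((g ^ n * h ^ n)⁻¹ * (g * h) ^ n) := by group
    have h1 := le_map_mul φ (g ^ n * h ^ n) ((g ^ n * h ^ n)⁻¹ * (g * h) ^ n)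
    have h2 := map_mul_le φ (g ^ n * h ^ n) ((g ^ n * h ^ n)⁻¹ * (g * h) ^ n)
    rw [← e, hk] at h1 h2
    have h3 := le_map_mul φ (g ^ n) (h ^ n)
    have h4 := map_mul_le φ (g ^ n) (h ^ n)
    rw [mul_add, ← map_pow, ← map_pow, ← map_pow]
    exact abs_le.2 ⟨by linarith, by linarith⟩
  refine hD (le_antisymm (csInf_le ⟨0, fun c hc => (abs_nonneg _).trans (hc 1 1)⟩ ?_)
    (defect_nonneg φ))
  intro g h
  simp [hadd]

end Qh

open Qh

/-! ### Heights along paths -/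

section

variable {S : Finset G} {φ : Qh G}

theorem bddAbove_of_finite {ι : Type*} {B : Set ι} (hB : B.Finite) (f : ι → ℝ) :
    ∃ C, 0 ≤ C ∧ ∀ b ∈ B, f b ≤ C := by
  obtain ⟨C, hC⟩ := (hB.image f).bddAbove
  exact ⟨max C 0, le_max_right _ _, fun b hb => (hC ⟨b, hb, rfl⟩).trans (le_max_left _ _)⟩

/-- Steps by elements of a finite set can be replaced by paths that stay at bounded height from
their origin. -/
theorem exists_linked_step (hS : IsSymmGen S) (φ : Qh G) {B : Set G} (hB : B.Finite) :
    ∃ C, 0 ≤ C ∧ ∀ b ∈ B, ∀ g : G, Linked S {h | |φ.1 h - φ.1 g| ≤ C} g (g * b) := by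
  have h1 : ∀ b : G, ∃ C, 0 ≤ C ∧ Linked S {h | |φ.1 h| ≤ C} 1 b := fun b => by
    obtain ⟨F, -, hF⟩ := (linked_univ hS.closure_eq hS.inv_mem 1 b).exists_finset
    obtain ⟨C, hC, hFC⟩ := bddAbove_of_finite F.finite_toSet fun g => |φ.1 g|
    exact ⟨C, hC, hF.mono_right hFC⟩
  choose c hc hc' using h1
  obtain ⟨C, hC, hBC⟩ := bddAbove_of_finite hB c
  refine ⟨C + defect φ.1, add_nonneg hC (defect_nonneg φ), fun b hb g => ?_⟩
  rw [show Linked (S : Set G) {h | |φ.1 h - φ.1 g| ≤ C + defect φ.1} g (g * b) ↔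
    Linked (S : Set G) {h | |φ.1 h - φ.1 g| ≤ C + defect φ.1} (g * 1) (g * b) by rw [mul_one]]
  refine (hc' b).translate g fun a ha => ?_
  have h1 := le_map_mul φ g a
  have h2 := map_mul_le φ g a
  have h3 := abs_le.1 (show |φ.1 a| ≤ c b from ha)
  have h4 := hBC b hb
  rw [Set.mem_ofPred_eq]
  exact abs_le.2 ⟨by linarith, by linarith⟩

/-- Replacing the steps of a path by paths with steps in `S` loses a bounded amount of height. -/
theorem Linked.refine_lower {B : Set G} {C : ℝ}
    (hC : ∀ b ∈ B, ∀ g : G, Linked S {h | |φ.1 h - φ.1 g| ≤ C} g (g * b)) {a : ℝ} (hC0 : 0 ≤ C)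
    {x y : G} (h : Linked B {g | a < φ.1 g} x y) : Linked S {g | a - C < φ.1 g} x y := by
  refine h.map (f := id) ?_ fun u hu v hv huv => ?_
  · have : a < φ.1 x := h.left_mem
    change a - C < φ.1 x
    linarith
  · have h1 := hC _ huv u
    rw [mul_inv_cancel_left] at h1
    refine h1.mono_right fun w hw => ?_
    have h2 := (abs_le.1 (show |φ.1 w - φ.1 u| ≤ C from hw)).1
    have h3 : a < φ.1 u := hu
    change a - C < φ.1 w
    linarith

/-- Above height `K`, the edges issuing from `1` in the Cayley graph of `S` become connected after
right multiplication by `T`. -/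
def Pushes (S : Finset G) (φ : G → ℝ) (K : ℝ) (T : G) : Prop :=
  K < φ T ∧ ∀ s ∈ S, Linked S {g | K < φ g} T (s * T)

/-- Two points far above t^n are pulled back by t^(-n) into {φ > 0}, joined there and translated
back. This costs D for the translation and C for subdividing the steps, and t^n is chosen high
enough to absorb both. -/
theorem exists_pushes (hS : IsSymmGen S) (h : φ ∈ QSigma G) (K : ℝ) :
    ∃ T, Pushes S φ.1 K T := by
  obtain ⟨⟨t, ht⟩, B, hB, hlink⟩ := ApproxConnected.exists_linked h
  replace ht : 0 < φ.1 t := ht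
  obtain ⟨C, hC0, hC⟩ := exists_linked_step hS φ hB
  obtain ⟨c, hc0, hc⟩ := bddAbove_of_finite S.finite_toSet fun s => |φ.1 s|
  obtain ⟨n, hn⟩ := exists_gt ht (K + C + defect φ.1)
  obtain ⟨m, hm⟩ := exists_gt ht (|K| + φ.1 (t ^ n) + c + 2 * defect φ.1)
  have hD := defect_nonneg φ
  have key : ∀ x y, φ.1 (t ^ n) + defect φ.1 < φ.1 x → φ.1 (t ^ n) + defect φ.1 < φ.1 y →
      Linked S {g | K < φ.1 g} x y := by
    intro x y hx hy
    have hpos : ∀ z, φ.1 (t ^ n) + defect φ.1 < φ.1 z → 0 < φ.1 ((t ^ n)⁻¹ * z) := fun z hz => by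
      have := le_map_mul φ (t ^ n)⁻¹ z
      rw [Qh.map_inv] at this
      linarith
    have h1 := (hlink _ (hpos x hx) _ (hpos y hy)).translate
      (A' := {g | φ.1 (t ^ n) - defect φ.1 < φ.1 g}) (t ^ n) fun a ha => by
        have h1 := le_map_mul φ (t ^ n) a
        have h2 : 0 < φ.1 a := ha
        rw [Set.mem_ofPred_eq]
        linarith
    rw [mul_inv_cancel_left, mul_inv_cancel_left] at h1
    refine (h1.refine_lower hC hC0).mono_right fun w hw => ?_
    have h2 : φ.1 (t ^ n) - defect φ.1 - C < φ.1 w := hw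
    rw [Set.mem_ofPred_eq]
    linarith
  have habs := le_abs_self K
  have habs' := abs_nonneg K
  refine ⟨t ^ m, by linarith [abs_nonneg K], fun s hs => key _ _ (by linarith) ?_⟩
  have h1 := le_map_mul φ s (t ^ m)
  have h2 := (abs_le.1 (hc s hs)).1
  linarith

/-- The edges can be pushed along a path contained in a finite set. -/
theorem Pushes.exists_finset {f : G → ℝ} {K : ℝ} {T : G} (h : Pushes S f K T) :
    ∃ F : Finset G, (F : Set G) ⊆ {g | K < f g} ∧ T ∈ F ∧ ∀ s ∈ S, Linked S F T (s * T) := by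
  classical
  choose! F hF hF' using fun s hs => (h.2 s hs).exists_finset
  refine ⟨insert T (S.biUnion F), ?_, by simp, fun s hs => (hF' s hs).mono_right ?_⟩
  · intro g hg
    simp only [Finset.coe_insert, Finset.coe_biUnion, Set.mem_insert_iff, Set.mem_iUnion] at hg
    obtain rfl | ⟨s, hs, hg⟩ := hg
    · exact h.1
    · exact hF s hs hg
  · refine subset_trans ?_ (Finset.coe_subset.2 (Finset.subset_insert _ _))
    exact Finset.coe_subset.2 (Finset.subset_biUnion_of_mem F hs)

theorem exists_gap {G : Type*} {F : Finset G} {f : G → ℝ} {K : ℝ} (hF : (F : Set G) ⊆ {g | K < f g}) :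
    ∃ ε, 0 < ε ∧ ∀ g ∈ F, K + ε ≤ f g := by
  obtain rfl | hne := F.eq_empty_or_nonempty
  · exact ⟨1, one_pos, by simp⟩
  obtain ⟨g, hg, hmin⟩ := F.exists_min_image f hne
  exact ⟨f g - K, sub_pos.2 (hF hg), fun x hx => by linarith [hmin x hx]⟩

theorem mem_QSigma_of_pushes (hG : Group.FG G) (hS : IsSymmGen S) {T : G}
    (h : Pushes S φ.1 (defect φ.1) T) : φ ∈ QSigma G := by
  obtain ⟨F, hF, hTF, hpush⟩ := h.exists_finset
  obtain ⟨ε, hε, hFε⟩ := exists_gap hF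
  have hT := h.1
  have hD := defect_nonneg φ
  -- The edge from u to us becomes the u-translate of the path from T to sT. Its points lie above a
  -- + (D + ε) - D.
  have hraise : ∀ (a : ℝ) (x y : G), Linked S {g | a ≤ φ.1 g} x y →
      Linked S {g | a + ε ≤ φ.1 g} (x * T) (y * T) := by
    intro a x y hxy
    have hup : ∀ u ∈ {g | a ≤ φ.1 g}, ∀ w ∈ (F : Set G), u * w ∈ {g | a + ε ≤ φ.1 g} := by
      intro u hu w hw
      have h1 := le_map_mul φ u w
      have h2 : a ≤ φ.1 u := hu
      have h3 := hFε w hw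
      rw [Set.mem_ofPred_eq]
      linarith
    refine hxy.map (f := (· * T)) (hup _ hxy.left_mem _ hTF) fun u hu v hv huv => ?_
    have h1 := (hpush _ huv).translate u (hup u hu)
    simpa [mul_assoc] using h1
  have hraise' : ∀ (n : ℕ) (a : ℝ) (x y : G), Linked S {g | a ≤ φ.1 g} x y →
      Linked S {g | a + n * ε ≤ φ.1 g} (x * T ^ n) (y * T ^ n) := by
    intro n
    induction n with
    | zero => intro a x y h; simpa using h
    | succ n ih =>
      intro a x y h
      have := hraise _ _ _ (ih a x y h)
      rw [mul_assoc, mul_assoc, ← pow_succ, add_assoc, ← add_one_mul] at this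
      exact_mod_cast this
  classical
  refine approxConnected_of_linked hG (B := ((S ∪ {T, T⁻¹} : Finset G) : Set G))
    (Finset.finite_toSet _) ⟨T, lt_of_le_of_lt hD hT⟩ fun x hx y hy => ?_
  have hB : ∀ b ∈ ((S ∪ {T, T⁻¹} : Finset G) : Set G),
      b⁻¹ ∈ ((S ∪ {T, T⁻¹} : Finset G) : Set G) := by
    intro b hb
    simp only [Finset.coe_union, Finset.coe_insert, Finset.coe_singleton, Set.mem_union,
      Set.mem_insert_iff, Set.mem_singleton_iff] at hb ⊢
    rcases hb with hb | rfl | rfl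
    · exact .inl (hS.inv_mem b hb)
    · simp
    · simp
  -- By homogeneity the defect is paid only once along the ray, and φ(T) > D already covers it at
  -- the first step.
  have hray : ∀ z ∈ {g | 0 < φ.1 g}, ∀ n : ℕ,
      Linked ((S ∪ {T, T⁻¹} : Finset G) : Set G) {g | 0 < φ.1 g} z (z * T ^ n) := by
    intro z hz n
    induction n with
    | zero => simpa using Linked.refl hz
    | succ n ih =>
      refine ih.trans (.step ih.right_mem ?_ (by simp [pow_succ]))
      have h1 := le_map_mul φ z (T ^ (n + 1))
      have h2 : 0 < φ.1 z := hz
      rw [Qh.map_pow] at h1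
      push_cast at h1
      have : (0 : ℝ) ≤ n * φ.1 T := mul_nonneg n.cast_nonneg (hD.trans hT.le)
      rw [Set.mem_ofPred_eq]
      linarith
  obtain ⟨F', -, hF'⟩ := (linked_univ hS.closure_eq hS.inv_mem x y).exists_finset
  obtain ⟨a, ha, hF'a⟩ := bddAbove_of_finite F'.finite_toSet fun g => -φ.1 g
  obtain ⟨n, hn⟩ := exists_nat_gt (a / ε)
  rw [div_lt_iff₀ hε] at hn
  have hmid := hraise' n (-a) x y (hF'.mono_right fun g hg => neg_le.1 (hF'a g hg))
  refine ((hray x hx n).trans (hmid.mono (by simp [Set.subset_def]; tauto) fun w hw => ?_)).trans ((hray y hy n).symm hB)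
  have : -a + n * ε ≤ φ.1 w := hw
  rw [Set.mem_ofPred_eq]
  linarith

end

theorem isOpen_QSigma (hG : Group.FG G) : IsOpen[sliceTopology G] (QSigma G) := by
  obtain ⟨S, hS⟩ := exists_isSymmGen hG
  refine isOpen_iSup_iff.2 fun D => isOpen_coinduced.2 ?_
  let _ : TopologicalSpace {φ : Qh G // defect (φ : G → ℝ) = D} :=
    TopologicalSpace.induced (fun φ => ((φ.1 : Qh G) : G → ℝ)) Pi.topologicalSpace
  refine isOpen_iff_forall_mem_open.2 fun φ hφ => ?_
  obtain ⟨T, hT⟩ := exists_pushes hS (φ := φ.1) hφ (defect φ.1.1)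
  obtain ⟨F, hF, hTF, hpush⟩ := hT.exists_finset
  rw [φ.2] at hF
  -- The same T and the same paths serve for every ψ of defect D that exceeds D on the finite set F.
  refine ⟨{ψ | ∀ g ∈ F, D < ψ.1.1 g}, fun ψ hψ => ?_, ?_, fun g hg => hF hg⟩
  · refine mem_QSigma_of_pushes hG hS (T := T) ?_
    rw [ψ.2]
    exact ⟨hψ T hTF, fun s hs => (hpush s hs).mono_right hψ⟩
  · have hcont : Continuous fun ψ : {φ : Qh G // defect (φ : G → ℝ) = D} => ψ.1.1 :=
      continuous_induced_dom
    have : {ψ : {φ : Qh G // defect (φ : G → ℝ) = D} | ∀ g ∈ F, D < ψ.1.1 g} =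
        ⋂ g ∈ F, {ψ | D < ψ.1.1 g} := by ext; simp
    rw [this]
    exact isOpen_biInter_finset fun g _ =>
      isOpen_lt continuous_const ((continuous_apply g).comp hcont)

/-! ### Approximate kernels -/

section

variable {S : Finset G} {φ : Qh G}

theorem mem_Aker {g : G} : g ∈ Aker φ ↔ |φ.1 g| ≤ 2 * defect φ.1 := Iff.rfl

/-- Elements of bounded height can be moved to the approximate kernel by finitely many right
multiplications. -/
theorem exists_finset_mul_mem_Aker (hD : defect φ.1 ≠ 0) (R : ℝ) :
    ∃ Y : Finset G, 1 ∈ Y ∧ ∀ v, |φ.1 v| ≤ R → ∃ y ∈ Y, v * y ∈ Aker φ := by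
  classical
  obtain ⟨t, ht, htD⟩ := exists_pos_le_defect hD
  obtain ⟨M, hM⟩ := exists_nat_gt (R / φ.1 t)
  rw [div_lt_iff₀ ht] at hM
  refine ⟨(Finset.Icc (-M : ℤ) M).image fun k => t ^ k, ?_, fun v hv => ?_⟩
  · exact Finset.mem_image.2 ⟨0, by simp, by simp⟩
  -- φ(v) + kφ(t) lies in [0, φ(t)), so the height of v t^k lies between -D and φ(t) + D ≤ 2D; this
  -- is where the constant 2D is needed.
  set k : ℤ := -⌊φ.1 v / φ.1 t⌋ with hk
  have h1 := Int.floor_le (φ.1 v / φ.1 t)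
  have h2 := Int.lt_floor_add_one (φ.1 v / φ.1 t)
  have hv' := abs_le.1 hv
  have hMlo : (-M : ℤ) ≤ ⌊φ.1 v / φ.1 t⌋ := by
    rw [Int.le_floor, le_div_iff₀ ht]
    push_cast
    linarith
  have hMhi : ⌊φ.1 v / φ.1 t⌋ ≤ M := by
    have : φ.1 v / φ.1 t < M := by
      rw [div_lt_iff₀ ht]
      linarith
    exact_mod_cast h1.trans this.le
  rw [le_div_iff₀ ht] at h1
  rw [div_lt_iff₀ ht, add_mul, one_mul] at h2
  refine ⟨t ^ k, Finset.mem_image.2 ⟨k, Finset.mem_Icc.2 ⟨by omega, by omega⟩, rfl⟩, ?_⟩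
  have h3 := le_map_mul φ v (t ^ k)
  have h4 := map_mul_le φ v (t ^ k)
  rw [Qh.map_zpow, hk] at h3 h4
  push_cast at h3 h4
  have hD := defect_nonneg φ
  exact mem_Aker.2 (abs_le.2 ⟨by linarith, by linarith⟩)

theorem isApproxGroup_Aker (hD : defect φ.1 ≠ 0) : IsApproxGroup (Aker φ) := by
  classical
  obtain ⟨Y, -, hY⟩ := exists_finset_mul_mem_Aker hD (5 * defect φ.1)
  refine ⟨Y⁻¹, ?_⟩
  rintro _ ⟨g, hg, h, hh, rfl⟩
  have h1 := abs_le.1 (mem_Aker.1 hg)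
  have h2 := abs_le.1 (mem_Aker.1 hh)
  have h3 := le_map_mul φ g h
  have h4 := map_mul_le φ g h
  obtain ⟨y, hy, hgy⟩ := hY (g * h) (abs_le.2 ⟨by linarith, by linarith⟩)
  exact ⟨g * h * y, hgy, y⁻¹, by simpa using hy, by simp⟩

theorem mem_QSigma_of_approxConnected_Aker (hG : Group.FG G) (hD : defect φ.1 ≠ 0)
    (h : ApproxConnected (Aker φ)) : φ ∈ QSigma G := by
  obtain ⟨-, B, hB, hlink⟩ := h.exists_linked
  obtain ⟨t, ht, htD⟩ := exists_pos_le_defect hD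
  have hDnn := defect_nonneg φ
  -- As φ(t) ≤ D, the point xt may fail to have positive height. The ray therefore starts with a
  -- single jump by t^M, which outweighs the defect.
  obtain ⟨M, hM⟩ := exists_gt ht (defect φ.1)
  rw [Qh.map_pow] at hM
  set B' : Set G := B ∪ B⁻¹ ∪ {t, t⁻¹, t ^ M, (t ^ M)⁻¹} with hB'
  have hB'inv : ∀ b ∈ B', b⁻¹ ∈ B' := by
    intro b hb
    simp only [hB', Set.mem_union, Set.mem_inv, Set.mem_insert_iff, Set.mem_singleton_iff,
      inv_inv, inv_eq_iff_eq_inv] at hb ⊢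
    tauto
  have hpos : ∀ x, 0 < φ.1 x → ∀ n, M ≤ n → 0 < φ.1 (x * t ^ n) := by
    intro x hx n hn
    have h1 := le_map_mul φ x (t ^ n)
    rw [Qh.map_pow] at h1
    have h2 : (M : ℝ) * φ.1 t ≤ n * φ.1 t := by gcongr
    linarith
  have hray : ∀ x, 0 < φ.1 x → ∀ n, M ≤ n → Linked B' {g | 0 < φ.1 g} x (x * t ^ n) := by
    intro x hx n hn
    induction n, hn using Nat.le_induction with
    | base => exact .step_mul (by simp [hB']) hx (hpos x hx M le_rfl)
    | succ n hn ih =>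
      refine ih.trans ?_
      rw [pow_succ, ← mul_assoc]
      refine .step_mul (by simp [hB']) ih.right_mem ?_
      rw [mul_assoc, ← pow_succ]
      exact hpos x hx _ (by omega)
  refine approxConnected_of_linked hG (B := B') ?_ ⟨t, ht⟩ fun x hx y hy => ?_
  · exact (hB.union hB.inv).union (by simp)
  replace hx : 0 < φ.1 x := hx
  replace hy : 0 < φ.1 y := hy
  obtain ⟨k, hk⟩ : ∃ k : ℤ, |φ.1 (x⁻¹ * y * t ^ k)| ≤ 2 * defect φ.1 := by
    set v := φ.1 (x⁻¹ * y) with hv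
    have h1 := Int.floor_le (v / φ.1 t)
    have h2 := Int.lt_floor_add_one (v / φ.1 t)
    rw [le_div_iff₀ ht] at h1
    rw [div_lt_iff₀ ht, add_mul, one_mul] at h2
    refine ⟨-⌊v / φ.1 t⌋, ?_⟩
    have h3 := le_map_mul φ (x⁻¹ * y) (t ^ (-⌊v / φ.1 t⌋))
    have h4 := map_mul_le φ (x⁻¹ * y) (t ^ (-⌊v / φ.1 t⌋))
    rw [Qh.map_zpow] at h3 h4
    push_cast at h3 h4
    exact abs_le.2 ⟨by linarith, by linarith⟩
  obtain ⟨n₀, hn₀⟩ := exists_nat_gt (4 * defect φ.1 / φ.1 t)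
  rw [div_lt_iff₀ ht] at hn₀
  -- The term n₀ lifts x t^n above 3D: a translate of a path in the kernel loses at most 2D + D and
  -- stays positive. The term |k| ensures that m = n + k is still at least M.
  set n : ℕ := M + n₀ + k.natAbs with hn
  obtain ⟨m, hm⟩ : ∃ m : ℕ, (m : ℤ) = n + k := ⟨(n + k).toNat, by omega⟩
  have hmem : (x * t ^ n)⁻¹ * (y * t ^ m) ∈ Aker φ := by
    -- Conjugation does not change height, so climbing along t preserves membership in the kernel.
    have e : (x * t ^ n)⁻¹ * (y * t ^ m) = (t ^ n)⁻¹ * (x⁻¹ * y * t ^ k) * (t ^ n)⁻¹⁻¹ := by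
      rw [← zpow_natCast t m, hm, add_comm, zpow_add, zpow_natCast]
      group
    rw [mem_Aker, e, map_conj]
    exact hk
  have hhigh : 3 * defect φ.1 < φ.1 (x * t ^ n) := by
    have h1 := le_map_mul φ x (t ^ n)
    rw [Qh.map_pow] at h1
    have h2 : (n₀ : ℝ) * φ.1 t ≤ n * φ.1 t := by
      gcongr
      omega
    linarith
  have hmid := (hlink 1 (mem_Aker.2 (by rw [Qh.map_one, abs_zero]; linarith)) _ hmem).translate
    (A' := {g | 0 < φ.1 g}) (x * t ^ n) fun a ha => by
      have h1 := (abs_le.1 (mem_Aker.1 ha)).1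
      have h2 := le_map_mul φ (x * t ^ n) a
      rw [Set.mem_ofPred_eq]
      linarith
  rw [mul_one, mul_inv_cancel_left] at hmid
  have hBB' : B ⊆ B' := fun b hb => .inl (.inl hb)
  exact ((hray x hx n (by omega)).trans (hmid.mono hBB' subset_rfl)).trans
    ((hray y hy m (by omega)).symm hB'inv)

/-- If the edges of the Cayley graph can be pushed down, then paths that are bounded below can be
moved into a region of bounded height. -/
theorem exists_linked_bounded (hS : IsSymmGen S) (h : -φ ∈ QSigma G) {C₀ : ℝ} :
    ∃ C, ∀ x ∈ Aker φ, ∀ y ∈ Aker φ, Linked S {g | -C₀ ≤ φ.1 g} x y →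
      Linked S {g | |φ.1 g| ≤ C} x y := by
  classical
  have hD := defect_nonneg φ
  obtain ⟨T, hT⟩ := exists_pushes hS h (defect φ.1)
  obtain ⟨F, hF, hTF, hpush⟩ := hT.exists_finset
  obtain ⟨ε, hε, hFε⟩ := exists_gap hF
  simp only [neg_val_apply] at hFε
  obtain ⟨L, hL, hFL⟩ := bddAbove_of_finite F.finite_toSet fun g => -φ.1 g
  obtain ⟨c, hc, hstep⟩ := exists_linked_step hS φ (B := ((insert T S : Finset G) : Set G))
    (Finset.finite_toSet _)
  -- Points of the kernel lie below T₀ and are not moved. Points above T₀ sink by at most L + D and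
  -- so remain above -|C₀|. An edge crossing T₀ rises by at most c, and the detour to vT by another
  -- c, whence T₁.
  set T₀ := 2 * defect φ.1 + L + c + |C₀| with hT₀
  set T₁ := T₀ + 2 * c with hT₁
  have hC₀ := neg_abs_le C₀
  have hC₀' := abs_nonneg C₀
  -- Only the vertices above T₀ are multiplied by T, so each round lowers the peaks by ε without
  -- touching the endpoints.
  have hlower : ∀ M, ∀ x ∈ Aker φ, ∀ y ∈ Aker φ, Linked S {g | -|C₀| ≤ φ.1 g ∧ φ.1 g ≤ M} x y →
      Linked S {g | -|C₀| ≤ φ.1 g ∧ φ.1 g ≤ max (M - ε) T₁} x y := by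
    intro M x hx y hy hxy
    set f : G → G := fun g => if φ.1 g ≤ T₀ then g else g * T with hf
    have hlow : ∀ g, φ.1 g ≤ T₀ → f g = g := fun g hg => if_pos hg
    have hhigh : ∀ g, ¬ φ.1 g ≤ T₀ → f g = g * T := fun g hg => if_neg hg
    have hA : ∀ g ∈ Aker φ, f g = g := fun g hg => hlow g (by
      have := (abs_le.1 (mem_Aker.1 hg)).2
      linarith)
    have hdrop : ∀ u, φ.1 u ≤ M → ¬ φ.1 u ≤ T₀ → ∀ w ∈ (F : Set G),
        u * w ∈ {g | -|C₀| ≤ φ.1 g ∧ φ.1 g ≤ max (M - ε) T₁} := by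
      intro u hu hu' w hw
      have h1 := le_map_mul φ u w
      have h2 := map_mul_le φ u w
      have h3 := hFε w hw
      have h4 := hFL w hw
      exact ⟨by linarith, le_max_of_le_left (by linarith)⟩
    have hmix : ∀ u v, -|C₀| ≤ φ.1 u → φ.1 u ≤ T₀ → ¬ φ.1 v ≤ T₀ → u⁻¹ * v ∈ (S : Set G) →
        Linked S {g | -|C₀| ≤ φ.1 g ∧ φ.1 g ≤ max (M - ε) T₁} u (v * T) := by
      intro u v hu0 hu hv huv
      have hv' : φ.1 v ≤ T₀ + c := by
        have h1 := (hstep (u⁻¹ * v) (by simpa using Or.inr huv) u).right_mem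
        rw [mul_inv_cancel_left] at h1
        have := (abs_le.1 (show |φ.1 v - φ.1 u| ≤ c from h1)).2
        linarith
      refine Linked.trans (.step ⟨hu0, le_max_of_le_right (by linarith)⟩
        ⟨by linarith, le_max_of_le_right (by linarith)⟩ huv)
        ((hstep T (by simp) v).mono_right fun w hw => ?_)
      have := abs_le.1 (show |φ.1 w - φ.1 v| ≤ c from hw)
      exact ⟨by linarith, le_max_of_le_right (by linarith)⟩
    rw [← hA x hx, ← hA y hy]
    refine hxy.map ?_ fun u hu v hv huv => ?_
    · rw [hA x hx]
      have := (abs_le.1 (mem_Aker.1 hx)).2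
      exact ⟨hxy.left_mem.1, le_max_of_le_right (by linarith)⟩
    by_cases hu' : φ.1 u ≤ T₀ <;> by_cases hv' : φ.1 v ≤ T₀
    · rw [hlow u hu', hlow v hv']
      exact .step ⟨hu.1, le_max_of_le_right (by linarith)⟩
        ⟨hv.1, le_max_of_le_right (by linarith)⟩ huv
    · rw [hlow u hu', hhigh v hv']
      exact hmix u v hu.1 hu' hv' huv
    · rw [hhigh u hu', hlow v hv']
      exact (hmix v u hv.1 hv' hu' (by simpa using hS.inv_mem _ huv)).symm hS.inv_mem
    · rw [hhigh u hu', hhigh v hv']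
      simpa [mul_assoc] using (hpush _ huv).translate u (hdrop u hu.2 hu')
  have hiter : ∀ n : ℕ, ∀ M, M ≤ T₁ + n * ε → ∀ x ∈ Aker φ, ∀ y ∈ Aker φ,
      Linked S {g | -|C₀| ≤ φ.1 g ∧ φ.1 g ≤ M} x y →
      Linked S {g | -|C₀| ≤ φ.1 g ∧ φ.1 g ≤ T₁} x y := by
    intro n
    induction n with
    | zero =>
      intro M hM x hx y hy hxy
      exact hxy.mono_right fun g hg => ⟨hg.1, hg.2.trans (by simpa using hM)⟩
    | succ n ih =>
      intro M hM x hx y hy hxy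
      refine ih _ (max_le ?_ ?_) x hx y hy (hlower M x hx y hy hxy)
      · push_cast at hM
        linarith
      · have : 0 ≤ n * ε := by positivity
        linarith
  refine ⟨T₁, fun x hx y hy hxy => ?_⟩
  obtain ⟨F', hF', hxy'⟩ := hxy.exists_finset
  obtain ⟨M, -, hM⟩ := bddAbove_of_finite F'.finite_toSet φ.1
  obtain ⟨n, hn⟩ := exists_nat_gt ((M - T₁) / ε)
  rw [div_lt_iff₀ hε] at hn
  refine (hiter n M (by linarith) x hx y hy (hxy'.mono_right fun g hg => ⟨?_, hM g hg⟩)).mono_right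
    fun g hg => abs_le.2 ⟨?_, hg.2⟩
  · have : -C₀ ≤ φ.1 g := hF' hg
    linarith [le_abs_self C₀]
  · linarith [hg.1]

theorem approxConnected_Aker (hG : Group.FG G) (hD : defect φ.1 ≠ 0)
    (h : φ ∈ QSigma G) (h' : -φ ∈ QSigma G) : ApproxConnected (Aker φ) := by
  classical
  obtain ⟨S, hS⟩ := exists_isSymmGen hG
  have hDnn := defect_nonneg φ
  obtain ⟨⟨t, ht⟩, B, hB, hlink⟩ := ApproxConnected.exists_linked h
  obtain ⟨k, hk⟩ := exists_gt (show 0 < φ.1 t from ht) (3 * defect φ.1)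
  obtain ⟨c, hc, hstep⟩ := exists_linked_step hS φ (hB.union (Set.finite_singleton (t ^ k)))
  obtain ⟨C, hC⟩ := exists_linked_bounded hS h' (C₀ := 2 * defect φ.1 + c)
  obtain ⟨Y, hY1, hY⟩ := exists_finset_mul_mem_Aker hD C
  -- The correction is trivial on the kernel, so moving the band |φ| ≤ C into the kernel fixes the
  -- ends of the path; its steps then lie in the finite set Y⁻¹SY.
  have hY' : ∀ v, ∃ y ∈ Y, (v ∈ Aker φ → y = 1) ∧ (|φ.1 v| ≤ C → v * y ∈ Aker φ) := by
    intro v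
    by_cases hv : v ∈ Aker φ
    · exact ⟨1, hY1, fun _ => rfl, fun _ => by simpa⟩
    by_cases hv' : |φ.1 v| ≤ C
    · obtain ⟨y, hy, hvy⟩ := hY v hv'
      exact ⟨y, hy, fun h => absurd h hv, fun _ => hvy⟩
    · exact ⟨1, hY1, fun h => absurd h hv, fun h => absurd h hv'⟩
  choose r hrY hr1 hr using hY'
  refine approxConnected_of_linked hG (B := ((Y⁻¹ * S * Y : Finset G) : Set G))
    (Finset.finite_toSet _) ⟨1, mem_Aker.2 (by rw [Qh.map_one, abs_zero]; linarith)⟩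
    fun x hx y hy => ?_
  have hup : ∀ z ∈ Aker φ, 0 < φ.1 (z * t ^ k) ∧
      Linked S {g | -(2 * defect φ.1 + c) ≤ φ.1 g} z (z * t ^ k) := by
    intro z hz
    have h1 := (abs_le.1 (mem_Aker.1 hz)).1
    have h2 := le_map_mul φ z (t ^ k)
    refine ⟨by linarith, (hstep (t ^ k) (by simp) z).mono_right fun w hw => ?_⟩
    have h3 := (abs_le.1 (show |φ.1 w - φ.1 z| ≤ c from hw)).1
    rw [Set.mem_ofPred_eq]
    linarith
  have hmid := (hlink _ (hup x hx).1 _ (hup y hy).1).refine_lower (S := S)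
    (fun b hb => hstep b (.inl hb)) hc
  have hpath := hC x hx y hy (((hup x hx).2.trans (hmid.mono_right fun w hw => by
    have : 0 - c < φ.1 w := hw
    rw [Set.mem_ofPred_eq]
    linarith)).trans ((hup y hy).2.symm hS.inv_mem))
  have hfin := hpath.map (f := fun v => v * r v) (A' := Aker φ)
    (B' := ((Y⁻¹ * S * Y : Finset G) : Set G)) (hr x hpath.left_mem) fun u hu v hv huv => by
      refine .step (hr u hu) (hr v hv) ?_
      rw [show (u * r u)⁻¹ * (v * r v) = (r u)⁻¹ * (u⁻¹ * v) * r v by group]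
      exact Finset.mul_mem_mul (Finset.mul_mem_mul (by simpa using hrY u) huv) (hrY v)
  simpa [hr1 x hx, hr1 y hy] using hfin

theorem approxFinGen_Aker_iff (hG : Group.FG G) (hD : defect φ.1 ≠ 0) :
    ApproxFinGen (Aker φ) ↔ φ ∈ QSigma G ∧ -φ ∈ QSigma G := by
  refine ⟨fun h => ⟨mem_QSigma_of_approxConnected_Aker hG hD h.2, ?_⟩,
    fun h => ⟨isApproxGroup_Aker hD, approxConnected_Aker hG hD h.1 h.2⟩⟩
  refine mem_QSigma_of_approxConnected_Aker hG (by rwa [defect_neg]) ?_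
  rw [Aker_neg]
  exact h.2

end

/-! ### Novikov chains -/

section

variable (φ : Qh G)

/-- Right multiplication by a group element on the Novikov ring. -/
def rmul (g : G) : novikov φ →+ novikov φ := (novikovRep φ g⁻¹).toAddMonoidHom

variable {φ}

theorem rmul_apply (g : G) (a : novikov φ) (k : G) :
    (rmul φ g a : G → ℤ) k = (a : G → ℤ) (k * g⁻¹) := rfl

theorem rmul_rmul (g h : G) (a : novikov φ) : rmul φ g (rmul φ h a) = rmul φ (h * g) a := by
  ext k
  simp [rmul_apply, mul_assoc]

theorem rmul_one (a : novikov φ) : rmul φ 1 a = a := by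
  ext k
  simp [rmul_apply]

variable (φ) in
/-- The boundary map on Novikov 1-chains. -/
def novikovBoundary : (G →₀ novikov φ) →+ novikov φ :=
  Finsupp.liftAddHom fun g => rmul φ g - AddMonoidHom.id _

@[simp]
theorem novikovBoundary_single (g : G) (a : novikov φ) :
    novikovBoundary φ (Finsupp.single g a) = rmul φ g a - a := by
  simp [novikovBoundary]

/-- A homomorphism on Novikov 1-chains that vanishes on boundaries. -/
def IsCocycleHom {M : Type*} [AddCommGroup M] (Λ : (G →₀ novikov φ) →+ M) : Prop :=
  ∀ (a : novikov φ) (g h : G), Λ (Finsupp.single (g * h) a) =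
    Λ (Finsupp.single g a) + Λ (Finsupp.single h (rmul φ g a))

theorem isCocycleHom_novikovBoundary : IsCocycleHom (novikovBoundary φ) := by
  intro a g h
  simp [rmul_rmul]

theorem d₁₀_novikovRep (z : G →₀ novikov φ) :
    groupHomology.d₁₀ (Rep.of (novikovRep φ)) z = novikovBoundary φ z := by
  induction z using Finsupp.induction_linear with
  | zero => simp
  | add f g hf hg => rw [map_add, map_add, hf, hg]
  | single g a =>
    rw [novikovBoundary_single]
    exact groupHomology.d₁₀_single (A := Rep.of (novikovRep φ)) g a

theorem d₂₁_novikovRep_single (g h : G) (a : novikov φ) :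
    groupHomology.d₂₁ (Rep.of (novikovRep φ)) (Finsupp.single (g, h) a) =
      Finsupp.single h (rmul φ g a) - Finsupp.single (g * h) a + Finsupp.single g a :=
  groupHomology.d₂₁_single (A := Rep.of (novikovRep φ)) (g, h) a

theorem IsCocycleHom.apply_eq_zero {M : Type*} [AddCommGroup M] {Λ : (G →₀ novikov φ) →+ M}
    (hΛ : IsCocycleHom Λ) (h : Subsingleton (novikovH1 φ)) {z : G →₀ novikov φ}
    (hz : novikovBoundary φ z = 0) : Λ z = 0 := by
  have hmem : z ∈ groupHomology.boundaries₁ (Rep.of (novikovRep φ)) :=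
    (groupHomology.H1π_eq_zero_iff (⟨z, (d₁₀_novikovRep z).trans hz⟩ :
      groupHomology.cycles₁ (Rep.of (novikovRep φ)))).1 (h.elim _ _)
  have hd : ∀ w : G × G →₀ novikov φ,
      Λ (groupHomology.d₂₁ (Rep.of (novikovRep φ)) w) = 0 := by
    intro w
    induction w using Finsupp.induction_linear with
    | zero => rw [map_zero]; exact map_zero Λ
    | add f g hf hg =>
      rw [map_add]
      exact (map_add Λ _ _).trans (by rw [hf, hg, add_zero])
    | single p a =>
      obtain ⟨g, h⟩ := p
      rw [d₂₁_novikovRep_single, map_add, map_sub, hΛ]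
      abel
  obtain ⟨w, rfl⟩ := hmem
  exact hd w

/-- The quotient of the chains by the boundaries is itself an admissible target, so a cycle killed
by all such homomorphisms is a boundary. Later arguments can thus avoid explicit 2-chains. -/
theorem novikovH1_subsingleton
    (h : ∀ z : G →₀ novikov φ, novikovBoundary φ z = 0 → ∀ (M : Type u) [AddCommGroup M]
      (Λ : (G →₀ novikov φ) →+ M), IsCocycleHom Λ → Λ z = 0) :
    Subsingleton (novikovH1 φ) := by
  refine subsingleton_of_forall_eq 0 fun x => ?_
  induction x using groupHomology.H1_induction_on with
  | h z =>
    refine (groupHomology.H1π_eq_zero_iff z).2 ((Submodule.Quotient.mk_eq_zero _).1 ?_)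
    refine h z.1 ((d₁₀_novikovRep z.1).symm.trans z.2) _
      (groupHomology.boundaries₁ (Rep.of (novikovRep φ))).mkQ.toAddMonoidHom ?_
    intro a g h
    change Submodule.Quotient.mk (p := groupHomology.boundaries₁ (Rep.of (novikovRep φ))) _ =
      Submodule.Quotient.mk _ + Submodule.Quotient.mk _
    rw [← Submodule.Quotient.mk_add, eq_comm, Submodule.Quotient.eq]
    refine ⟨Finsupp.single (g, h) a, (d₂₁_novikovRep_single g h a).trans ?_⟩
    abel

end

section

variable {S : Finset G} {φ : Qh G}

/-! ### Vanishing of Novikov homology -/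

/-- The 1-chain in which the edges of type `s` have coefficient `c s`. -/
def edgeChain (S : Finset G) (φ : Qh G) : (S → novikov φ) →+ (G →₀ novikov φ) :=
  ∑ s : S, (Finsupp.singleAddHom s.1).comp (Pi.evalAddMonoidHom _ s)

theorem edgeChain_apply (c : S → novikov φ) :
    edgeChain S φ c = ∑ s : S, Finsupp.single s.1 (c s) := by
  simp [edgeChain, AddMonoidHom.finsetSum_apply]

open Classical in
theorem edgeChain_single (s : S) (a : novikov φ) :
    edgeChain S φ (Pi.single s a) = Finsupp.single s.1 a := by
  rw [edgeChain_apply, Finset.sum_eq_single s]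
  · simp
  · intro t _ hts
    simp [Pi.single_eq_of_ne hts]
  · simp

open Classical in
/-- The chain of the edges `(a * q, s)` for `(q, s)` in a list. -/
def pathChain (S : Finset G) (φ : Qh G) (L : List (G × S)) : novikov φ →+ (S → novikov φ) :=
  (L.map fun p => (AddMonoidHom.single (fun _ : S => novikov φ) p.2).comp (rmul φ p.1)).sum

open Classical in
theorem pathChain_cons (p : G × S) (L : List (G × S)) (a : novikov φ) :
    pathChain S φ (p :: L) a = Pi.single p.2 (rmul φ p.1 a) + pathChain S φ L a := by
  simp [pathChain]

theorem pathChain_nil (a : novikov φ) : pathChain S φ [] a = 0 := by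
  simp [pathChain]

theorem pathChain_append (L L' : List (G × S)) (a : novikov φ) :
    pathChain S φ (L ++ L') a = pathChain S φ L a + pathChain S φ L' a := by
  simp [pathChain]

theorem IsCocycleHom.single_one {M : Type*} [AddCommGroup M] {Λ : (G →₀ novikov φ) →+ M}
    (hΛ : IsCocycleHom Λ) (a : novikov φ) : Λ (Finsupp.single 1 a) = 0 := by
  simpa [rmul_one] using hΛ a 1 1

/-- Up to boundaries, an edge from `x` to `y` can be replaced by a path. -/
theorem Linked.exists_pathChain {F : Set G} {x y : G} (h : Linked S F x y) :
    ∃ L : List (G × S), (∀ p ∈ L, p.1 ∈ F) ∧ ∀ (M : Type u) [AddCommGroup M]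
      (Λ : (G →₀ novikov φ) →+ M), IsCocycleHom Λ → ∀ a : novikov φ,
        Λ (edgeChain S φ (pathChain S φ L a)) = Λ (Finsupp.single (x⁻¹ * y) (rmul φ x a)) := by
  obtain ⟨hx, h⟩ := h
  have key : y ∈ F ∧ ∃ L : List (G × S), (∀ p ∈ L, p.1 ∈ F) ∧ ∀ (M : Type u) [AddCommGroup M]
      (Λ : (G →₀ novikov φ) →+ M), IsCocycleHom Λ → ∀ a : novikov φ,
        Λ (edgeChain S φ (pathChain S φ L a)) = Λ (Finsupp.single (x⁻¹ * y) (rmul φ x a)) := by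
    induction h with
    | refl =>
      refine ⟨hx, [], by simp, fun M _ Λ hΛ a => ?_⟩
      rw [pathChain_nil, map_zero, map_zero, inv_mul_cancel, hΛ.single_one]
    | @tail b c _ h ih =>
      obtain ⟨hb, L, hL, hL'⟩ := ih
      refine ⟨h.2, L ++ [(b, ⟨b⁻¹ * c, h.1⟩)], ?_, fun M _ Λ hΛ a => ?_⟩
      · simpa [or_imp, forall_and, hb] using hL
      rw [pathChain_append, map_add, map_add, hL' M Λ hΛ, pathChain_cons, pathChain_nil, add_zero,
        edgeChain_single, show x⁻¹ * c = (x⁻¹ * b) * (b⁻¹ * c) by group, hΛ _ (x⁻¹ * b), rmul_rmul,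
        mul_inv_cancel_left]
  exact key.2

/-- Up to boundaries, all chains are supported on the edges of a Cayley graph. -/
theorem exists_edgeChain (hS : IsSymmGen S) (z : G →₀ novikov φ) :
    ∃ c : S → novikov φ, ∀ (M : Type u) [AddCommGroup M] (Λ : (G →₀ novikov φ) →+ M),
      IsCocycleHom Λ → Λ (edgeChain S φ c) = Λ z := by
  induction z using Finsupp.induction_linear with
  | zero => exact ⟨0, fun M _ Λ _ => by simp⟩
  | add f g hf hg =>
    obtain ⟨c, hc⟩ := hf
    obtain ⟨d, hd⟩ := hg
    exact ⟨c + d, fun M _ Λ hΛ => by rw [map_add, map_add, hc M Λ hΛ, hd M Λ hΛ, map_add]⟩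
  | single g a =>
    obtain ⟨L, -, hL⟩ := (linked_univ hS.closure_eq hS.inv_mem 1 g).exists_pathChain (φ := φ)
    exact ⟨pathChain S φ L a, fun M _ Λ hΛ => by
      rw [hL M Λ hΛ, inv_one, one_mul, rmul_one]⟩

/-- Chains of Novikov elements supported in height at least `x`. -/
def chainsAbove (ι : Type*) (φ : Qh G) (x : ℝ) : AddSubgroup (ι → novikov φ) where
  carrier := {c | ∀ i g, φ.1 g < x → (c i).1 g = 0}
  zero_mem' := fun _ _ _ => rfl
  add_mem' := fun {a b} ha hb i g hg => by
    change (a i).1 g + (b i).1 g = 0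
    rw [ha i g hg, hb i g hg, add_zero]
  neg_mem' := fun {a} ha i g hg => by
    change -(a i).1 g = 0
    rw [ha i g hg, neg_zero]

theorem exists_mem_chainsAbove {ι : Type*} [Finite ι] (c : ι → novikov φ) :
    ∃ x, c ∈ chainsAbove ι φ x := by
  have h : ∀ a : novikov φ, ∃ x, ∀ g, a.1 g ≠ 0 → x ≤ φ.1 g := by
    intro a
    obtain ⟨C, hC0, hC⟩ := bddAbove_of_finite (a.2 0) fun g => -φ.1 g
    refine ⟨-C, fun g hg => ?_⟩
    by_cases h0 : φ.1 g < 0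
    · linarith [hC g ⟨h0, hg⟩]
    · linarith
  choose x hx using fun i => h (c i)
  obtain ⟨C, -, hC⟩ := bddAbove_of_finite (Set.finite_univ (α := ι)) fun i => -x i
  refine ⟨-C, fun i g hg => ?_⟩
  by_contra h0
  linarith [hx i g h0, hC i trivial]

/-- If `P` raises supports by a definite amount, then `1 - P` is surjective. -/
theorem exists_eq_add_apply {ι : Type*} (P : (ι → novikov φ) →+ (ι → novikov φ)) {ε : ℝ}
    (hε : 0 < ε) (hP : ∀ x, ∀ c ∈ chainsAbove ι φ x, P c ∈ chainsAbove ι φ (x + ε))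
    {c : ι → novikov φ} {x : ℝ} (hc : c ∈ chainsAbove ι φ x) : ∃ d, d = c + P d := by
  -- The partial sums of c + Pc + P²c + ⋯, starting at 0; the n-th increment is supported above x +
  -- nε, so each coefficient is eventually constant.
  set D : ℕ → ι → novikov φ := fun n => Nat.rec 0 (fun _ d => c + P d) n with hD
  have hD1 : ∀ n, D (n + 1) = c + P (D n) := fun n => rfl
  have hstep : ∀ n : ℕ, D (n + 1) - D n ∈ chainsAbove ι φ (x + n * ε) := by
    intro n
    induction n with
    | zero =>
      have : D (0 + 1) - D 0 = c := by simp [hD]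
      rw [this]
      simpa using hc
    | succ n ih =>
      have := hP _ _ ih
      rw [map_sub] at this
      rw [hD1 (n + 1), hD1 n, add_sub_add_left_eq_sub]
      convert this using 2
      push_cast
      ring
  have hmono : ∀ {y z : ℝ}, y ≤ z → chainsAbove ι φ z ≤ chainsAbove ι φ y :=
    fun hyz a ha i g hg => ha i g (hg.trans_le hyz)
  have hlim : ∀ n m : ℕ, n ≤ m → D m - D n ∈ chainsAbove ι φ (x + n * ε) := by
    intro n m hnm
    induction m, hnm using Nat.le_induction with
    | base => rw [sub_self]; exact zero_mem _
    | succ m hnm ih =>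
      rw [← sub_add_sub_cancel _ (D m)]
      refine add_mem (hmono ?_ (hstep m)) ih
      gcongr
  have hstable : ∀ (n m : ℕ) i g, φ.1 g < x + n * ε → φ.1 g < x + m * ε →
      (D n i).1 g = (D m i).1 g := by
    intro n m i g hn hm
    rcases le_total n m with h | h
    · exact (sub_eq_zero.1 (hlim n m h i g hn)).symm
    · exact sub_eq_zero.1 (hlim m n h i g hm)
  have hN : ∀ y : ℝ, ∃ n : ℕ, y < x + n * ε := by
    intro y
    obtain ⟨n, hn⟩ := exists_nat_gt ((y - x) / ε)
    rw [div_lt_iff₀ hε] at hn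
    exact ⟨n, by linarith⟩
  choose N hN using hN
  have hd : ∀ i (n : ℕ) g, φ.1 g < x + n * ε → (D (N (φ.1 g)) i).1 g = (D n i).1 g :=
    fun i n g hg => hstable _ _ _ _ (hN _) hg
  set d : ι → novikov φ := fun i => ⟨fun g => (D (N (φ.1 g)) i).1 g, fun y => by
    refine ((D (N y) i).2 y).subset ?_
    rintro g ⟨hg, h0⟩
    refine ⟨hg, ?_⟩
    rwa [← hd i (N y) g (hg.trans (hN y))]⟩ with hd'
  have hdn : ∀ n : ℕ, d - D n ∈ chainsAbove ι φ (x + n * ε) := fun n i g hg =>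
    sub_eq_zero.2 (hd i n g hg)
  refine ⟨d, ?_⟩
  ext i g
  set n := N (φ.1 g)
  -- Both d - D (n + 1) and P (d - D n) vanish below height x + nε, hence so does d - (c + P d), and
  -- n was chosen so that g lies there.
  have h1 := hP _ _ (hdn n)
  have h2 := add_mem (hmono (by push_cast; linarith : x + n * ε ≤ x + (n + 1 : ℕ) * ε)
    (hdn (n + 1))) (neg_mem (hmono (by linarith) h1))
  have h3 : d - D (n + 1) + -P (d - D n) = d - (c + P d) := by
    rw [hD1, map_sub]
    abel
  rw [h3] at h2
  exact sub_eq_zero.1 (h2 i g (hN _))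

/-- Invariance copies the coefficient at g to every g t⁻ⁿ. These heights tend to -∞, while the
support of a Novikov element is bounded below. -/
theorem eq_zero_of_rmul_eq {t : G} (ht : 0 < φ.1 t) {a : novikov φ} (ha : rmul φ t a = a) :
    a = 0 := by
  have hpow : ∀ (n : ℕ) (g : G), a.1 (g * t⁻¹ ^ n) = a.1 g := by
    intro n
    induction n with
    | zero => simp
    | succ n ih =>
      intro g
      rw [pow_succ, ← mul_assoc, ← rmul_apply, ha, ih]
  obtain ⟨x, hx⟩ := exists_mem_chainsAbove fun _ : Unit => a
  ext g
  obtain ⟨n, hn⟩ := exists_gt ht (φ.1 g + defect φ.1 - x)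
  rw [← hpow n g]
  refine hx () _ ?_
  have := map_mul_le φ g (t⁻¹ ^ n)
  rw [inv_pow, Qh.map_inv] at this
  rw [inv_pow]
  linarith

theorem Pushes.novikovH1_subsingleton (hS : IsSymmGen S) {T : G}
    (h : Pushes S φ.1 (defect φ.1) T) : Subsingleton (novikovH1 φ) := by
  classical
  obtain ⟨F, hF, -, hpush⟩ := h.exists_finset
  obtain ⟨ε, hε, hFε⟩ := exists_gap hF
  choose L hLF hL using fun s : S => (hpush s.1 s.2).exists_pathChain (φ := φ)
  -- P replaces each edge of type s by the translated path from T to sT.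
  set P : (S → novikov φ) →+ (S → novikov φ) :=
    ∑ s : S, (pathChain S φ (L s)).comp (Pi.evalAddMonoidHom _ s) with hP
  have hPc : ∀ c, P c = ∑ s : S, pathChain S φ (L s) (c s) := by
    intro c
    simp [hP, AddMonoidHom.finsetSum_apply]
  have hraise : ∀ x, ∀ c ∈ chainsAbove S φ x, P c ∈ chainsAbove S φ (x + ε) := by
    intro x c hc
    rw [hPc]
    refine sum_mem fun s _ => ?_
    have : ∀ L' : List (G × S), (∀ p ∈ L', p.1 ∈ (F : Set G)) →
        pathChain S φ L' (c s) ∈ chainsAbove S φ (x + ε) := by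
      intro L' hL'
      induction L' with
      | nil => rw [pathChain_nil]; exact zero_mem _
      | cons p L' ih =>
        rw [pathChain_cons]
        refine add_mem ?_ (ih fun q hq => hL' q (List.mem_cons_of_mem _ hq))
        intro i g hg
        by_cases hi : i = p.2
        · subst hi
          rw [Pi.single_eq_same, rmul_apply]
          refine hc s _ ?_
          have h1 := map_mul_le φ g p.1⁻¹
          have h2 := hFε p.1 (hL' p List.mem_cons_self)
          rw [Qh.map_inv] at h1
          linarith
        · rw [Pi.single_eq_of_ne hi]
          rfl
    exact this _ (hLF s)
  -- The prism over an edge: going along s and then T agrees, up to boundaries, with going along T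
  -- and then the pushed path. The vertical edges contribute the boundary of d.
  have hdiff : ∀ (M : Type u) [AddCommGroup M] (Λ : (G →₀ novikov φ) →+ M), IsCocycleHom Λ →
      ∀ d : S → novikov φ, Λ (edgeChain S φ d) - Λ (edgeChain S φ (P d)) =
        -Λ (Finsupp.single T (novikovBoundary φ (edgeChain S φ d))) := by
    intro M _ Λ hΛ d
    rw [hPc]
    simp only [map_sum, edgeChain_apply d, hL _ M Λ hΛ, Finsupp.single_finsetSum,
      novikovBoundary_single, Finsupp.single_sub, map_sub]
    rw [← Finset.sum_sub_distrib, ← Finset.sum_neg_distrib]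
    refine Finset.sum_congr rfl fun s _ => ?_
    have h1 := hΛ (d s) s T
    have h2 := hΛ (d s) T (T⁻¹ * (s * T))
    rw [mul_inv_cancel_left, h1] at h2
    rw [neg_sub, sub_eq_sub_iff_add_eq_add, h2]
  refine QuasiBNS.novikovH1_subsingleton fun z hz M _ Λ hΛ => ?_
  obtain ⟨c, hc⟩ := exists_edgeChain hS z
  obtain ⟨x, hx⟩ := exists_mem_chainsAbove c
  obtain ⟨d, hd⟩ := exists_eq_add_apply P hε hraise hx
  have hsplit : ∀ (M : Type u) [AddCommGroup M] (Λ : (G →₀ novikov φ) →+ M), IsCocycleHom Λ →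
      Λ z = -Λ (Finsupp.single T (novikovBoundary φ (edgeChain S φ d))) := by
    intro M _ Λ hΛ
    rw [← hdiff M Λ hΛ, ← hc M Λ hΛ, eq_sub_iff_add_eq, ← map_add, ← map_add, ← hd]
  -- Taking the boundary map itself as Λ shows that u, the boundary of d, satisfies uT = u. As φ(T)
  -- > 0 this forces u = 0, and the vertical term disappears for every Λ.
  have hu := hsplit _ _ isCocycleHom_novikovBoundary
  rw [hz, novikovBoundary_single, zero_eq_neg, sub_eq_zero] at hu
  rw [hsplit M Λ hΛ, eq_zero_of_rmul_eq ((defect_nonneg φ).trans_lt h.1) hu]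
  simp

end

section

variable {S : Finset G} {φ : Qh G}

/-! ### Consequences of the vanishing of Novikov homology -/

/-- The element of the Novikov ring with all coefficients in `A` equal to one. -/
def novikovIndicator (φ : Qh G) (A : Set G) (hA : ∀ x, {g | φ.1 g < x ∧ g ∈ A}.Finite) :
    novikov φ :=
  ⟨A.indicator 1, fun x => (hA x).subset fun _ hg => ⟨hg.1, Set.mem_of_indicator_ne_zero hg.2⟩⟩

/-- The element `x` of the Novikov ring. -/
def novikovPoint (φ : Qh G) (x : G) : novikov φ :=
  novikovIndicator φ {x} fun _ => (Set.finite_singleton x).subset fun _ hg => hg.2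

theorem le_map_mul_pow (x t : G) (n : ℕ) :
    φ.1 x + n * φ.1 t - defect φ.1 ≤ φ.1 (x * t ^ n) := by
  have := le_map_mul φ x (t ^ n)
  rwa [Qh.map_pow] at this

/-- The element `x + x t + x t ^ 2 + ⋯` of the Novikov ring. -/
def novikovRay {t : G} (ht : 0 < φ.1 t) (x : G) : novikov φ :=
  novikovIndicator φ {g | ∃ n : ℕ, g = x * t ^ n} fun y => by
    obtain ⟨N, hN⟩ := exists_nat_gt ((y - φ.1 x + defect φ.1) / φ.1 t)
    rw [div_lt_iff₀ ht] at hN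
    refine ((Set.finite_Iio N).image fun n => x * t ^ n).subset ?_
    rintro _ ⟨hg, n, rfl⟩
    refine ⟨n, ?_, rfl⟩
    have h1 := le_map_mul_pow (φ := φ) x t n
    have h2 : (n : ℝ) * φ.1 t < N * φ.1 t := by linarith
    exact_mod_cast lt_of_mul_lt_mul_right h2 ht.le

theorem rmul_novikovPoint (x g : G) :
    rmul φ g (novikovPoint φ x) = novikovPoint φ (x * g) := by
  classical
  ext k
  change ({x} : Set G).indicator (1 : G → ℤ) (k * g⁻¹) =
    ({x * g} : Set G).indicator (1 : G → ℤ) k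
  simp only [Set.indicator_apply, Set.mem_singleton_iff, mul_inv_eq_iff_eq_mul]
  rfl

theorem rmul_novikovRay {t : G} (ht : 0 < φ.1 t) (x : G) :
    rmul φ t (novikovRay ht x) - novikovRay ht x = -novikovPoint φ x := by
  classical
  rw [sub_eq_iff_eq_add, eq_neg_add_iff_add_eq, eq_comm]
  ext k
  change {g | ∃ n : ℕ, g = x * t ^ n}.indicator (1 : G → ℤ) k =
    ({x} : Set G).indicator (1 : G → ℤ) k +
      {g | ∃ n : ℕ, g = x * t ^ n}.indicator (1 : G → ℤ) (k * t⁻¹)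
  have h1 : (∃ n : ℕ, k = x * t ^ n) ↔ k = x ∨ ∃ n : ℕ, k * t⁻¹ = x * t ^ n := by
    constructor
    · rintro ⟨_ | n, rfl⟩
      · simp
      · exact .inr ⟨n, by simp [pow_succ, mul_assoc]⟩
    · rintro (rfl | ⟨n, hn⟩)
      · exact ⟨0, by simp⟩
      · exact ⟨n + 1, by rw [pow_succ, ← mul_assoc, ← hn, inv_mul_cancel_right]⟩
  have h2 : k = x → ¬ ∃ n : ℕ, k * t⁻¹ = x * t ^ n := by
    rintro rfl ⟨n, hn⟩
    have h3 := congrArg φ.1 (mul_left_cancel hn)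
    rw [Qh.map_inv, Qh.map_pow] at h3
    have h4 : 0 ≤ n * φ.1 t := by positivity
    linarith
  simp only [Set.indicator_apply, Set.mem_ofPred_eq, Set.mem_singleton_iff, h1, Pi.one_apply]
  by_cases hk : k = x
  · rw [if_pos (.inl hk), if_pos hk, if_neg (h2 hk), add_zero]
  · simp [hk]

/-- A set `K` is eventually invariant if right multiplication by any group element does not change
membership in `K`, at sufficiently large height. -/
def EventuallyInvariant (φ : Qh G) (K : Set G) : Prop :=
  ∀ g, ∃ R, ∀ k, R < φ.1 k → (k * g ∈ K ↔ k ∈ K)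

variable {K : Set G}

/-- The difference of indicators vanishes at large height, and a Novikov element has only finitely
many terms below any height. So infinite chains can be paired with this coboundary. -/
theorem EventuallyInvariant.finite (hK : EventuallyInvariant φ K) (g : G) (a : novikov φ) :
    (Function.support fun k =>
      (K.indicator (1 : G → ℤ) (k * g) - K.indicator (1 : G → ℤ) k) * a.1 k).Finite := by
  classical
  obtain ⟨R, hR⟩ := hK g
  refine (a.2 (R + 1)).subset fun k hk => ⟨?_, right_ne_zero_of_mul hk⟩
  by_contra hlt
  refine left_ne_zero_of_mul hk ?_
  simp only [Set.indicator_apply, hR k (by linarith), sub_self, Pi.one_apply]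

/-- The coboundary of the indicator function of an eventually invariant set, evaluated on Novikov
1-chains. -/
def indicatorCocycle (hK : EventuallyInvariant φ K) : (G →₀ novikov φ) →+ ℤ :=
  Finsupp.liftAddHom fun g => AddMonoidHom.mk'
    (fun a => ∑ᶠ k, (K.indicator (1 : G → ℤ) (k * g) - K.indicator (1 : G → ℤ) k) * a.1 k)
    fun a b => by
      rw [← finsum_add_distrib (hK.finite g a) (hK.finite g b)]
      refine finsum_congr fun k => ?_
      rw [← mul_add]
      rfl

theorem indicatorCocycle_single (hK : EventuallyInvariant φ K) (g : G) (a : novikov φ) :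
    indicatorCocycle hK (Finsupp.single g a) =
      ∑ᶠ k, (K.indicator (1 : G → ℤ) (k * g) - K.indicator (1 : G → ℤ) k) * a.1 k := by
  simp [indicatorCocycle]

theorem isCocycleHom_indicatorCocycle (hK : EventuallyInvariant φ K) :
    IsCocycleHom (indicatorCocycle hK) := by
  intro a g h
  have hfin := (hK.finite h (rmul φ g a)).preimage (mul_left_injective g).injOn
  simp only [indicatorCocycle_single]
  rw [← finsum_comp_equiv (Equiv.mulRight g) (f := fun k =>
    (K.indicator (1 : G → ℤ) (k * h) - K.indicator (1 : G → ℤ) k) * (rmul φ g a).1 k)]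
  refine (finsum_congr fun k => ?_).trans (finsum_add_distrib (hK.finite g a) hfin)
  simp only [Equiv.coe_mulRight, rmul_apply, mul_assoc, mul_inv_cancel, mul_one]
  ring

theorem indicatorCocycle_single_point (hK : EventuallyInvariant φ K) (g x : G) :
    indicatorCocycle hK (Finsupp.single g (novikovPoint φ x)) =
      K.indicator (1 : G → ℤ) (x * g) - K.indicator (1 : G → ℤ) x := by
  classical
  have hp : ∀ k, (novikovPoint φ x).1 k = ({x} : Set G).indicator (1 : G → ℤ) k := fun _ => rfl
  rw [indicatorCocycle_single, finsum_eq_single _ x]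
  · simp [hp]
  · intro k hk
    simp [hp, hk]

theorem indicatorCocycle_single_ray (hK : EventuallyInvariant φ K) {t : G} (ht : 0 < φ.1 t) (x : G)
    (h : ∀ n : ℕ, x * t ^ n * t ∈ K ↔ x * t ^ n ∈ K) :
    indicatorCocycle hK (Finsupp.single t (novikovRay ht x)) = 0 := by
  classical
  rw [indicatorCocycle_single]
  refine finsum_eq_zero_of_forall_eq_zero fun k => ?_
  by_cases hk : ∃ n : ℕ, k = x * t ^ n
  · obtain ⟨n, rfl⟩ := hk
    simp only [Set.indicator_apply, h n, sub_self, zero_mul, Pi.one_apply]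
  · exact mul_eq_zero_of_right _ (Set.indicator_of_notMem (s := {g | ∃ n : ℕ, g = x * t ^ n}) hk _)

/-- If the Novikov homology vanishes, eventually invariant sets do not separate the beginnings of
rays in which they are invariant. -/
theorem mem_iff_of_novikovH1_subsingleton (h : Subsingleton (novikovH1 φ))
    (hK : EventuallyInvariant φ K) {t : G} (ht : 0 < φ.1 t) {x y : G}
    (hx : ∀ n : ℕ, x * t ^ n * t ∈ K ↔ x * t ^ n ∈ K)
    (hy : ∀ n : ℕ, y * t ^ n * t ∈ K ↔ y * t ^ n ∈ K) : y ∈ K ↔ x ∈ K := by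
  classical
  -- The edge from x to y, followed by the ray out of y and preceded by the reversed ray into x, is
  -- a Novikov cycle: each ray has only its starting point as boundary, with sign -1. The rays
  -- contribute nothing to the cocycle, so the edge must not either.
  have h0 := (isCocycleHom_indicatorCocycle hK).apply_eq_zero h
    (z := Finsupp.single (x⁻¹ * y) (novikovPoint φ x) + (Finsupp.single t (novikovRay ht y) -
      Finsupp.single t (novikovRay ht x))) (by
    simp only [map_add, map_sub, novikovBoundary_single, rmul_novikovPoint, rmul_novikovRay,
      mul_inv_cancel_left]
    abel)
  rw [map_add, map_sub, indicatorCocycle_single_point, indicatorCocycle_single_ray hK ht x hx,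
    indicatorCocycle_single_ray hK ht y hy, sub_zero, add_zero, mul_inv_cancel_left,
    sub_eq_zero] at h0
  by_cases hxK : x ∈ K <;> by_cases hyK : y ∈ K <;> simp_all

theorem exists_pushes_of_novikovH1_subsingleton (hS : IsSymmGen S) (hφ : φ ≠ 0)
    (h : Subsingleton (novikovH1 φ)) : ∃ T, Pushes S φ.1 (defect φ.1) T := by
  have hD := defect_nonneg φ
  obtain ⟨t, ht⟩ := exists_pos hφ
  obtain ⟨c, hc0, hc⟩ := bddAbove_of_finite S.finite_toSet fun s => -φ.1 s
  have hlocal : ∀ g, ∃ R, 0 ≤ R ∧ ∀ k, defect φ.1 + R < φ.1 k →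
      Linked S {h | defect φ.1 < φ.1 h} k (k * g) := by
    intro g
    obtain ⟨R, hR0, hR⟩ := exists_linked_step hS φ (Set.finite_singleton g)
    refine ⟨R, hR0, fun k hk => (hR g rfl k).mono_right fun w hw => ?_⟩
    have := (abs_le.1 (show |φ.1 w - φ.1 k| ≤ R from hw)).1
    rw [Set.mem_ofPred_eq]
    linarith
  choose R hR0 hR using hlocal
  -- The height is chosen so that both t^m and s t^m exceed 2D + R(t): one D covers the loss along
  -- the ray, and D + R(t) is the threshold for invariance under t.
  obtain ⟨m, hm⟩ := exists_gt ht (2 * defect φ.1 + R t + c + defect φ.1)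
  have hRt := hR0 t
  -- K is the component of t^m in {φ > D}. It is eventually invariant because high up the step from
  -- k to kg is realised by a path inside {φ > D}.
  set K : Set G := {g | Linked S {h | defect φ.1 < φ.1 h} (t ^ m) g} with hKdef
  have hinv : ∀ g k, defect φ.1 + R g < φ.1 k → (k * g ∈ K ↔ k ∈ K) := fun g k hk =>
    ⟨fun h => h.trans ((hR g k hk).symm hS.inv_mem), fun h => h.trans (hR g k hk)⟩
  have hray : ∀ x, defect φ.1 + R t + defect φ.1 < φ.1 x → ∀ n : ℕ,
      (x * t ^ n * t ∈ K ↔ x * t ^ n ∈ K) := by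
    intro x hx n
    refine hinv t _ ?_
    have h1 := le_map_mul_pow (φ := φ) x t n
    have h2 : 0 ≤ n * φ.1 t := by positivity
    linarith
  have hTm : defect φ.1 < φ.1 (t ^ m) := by linarith
  refine ⟨t ^ m, hTm, fun s hs => ?_⟩
  refine (mem_iff_of_novikovH1_subsingleton h (K := K) (fun g => ⟨_, hinv g⟩) ht
    (hray (t ^ m) (by linarith)) (hray (s * t ^ m) ?_)).2 (Linked.refl hTm)
  have h1 := le_map_mul φ s (t ^ m)
  have h2 := hc s hs
  linarith

end

end QuasiBNS

end

theorem theorem1p2 (G : Type*) [Group G] (hG : Group.FG G) :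
    -- openness of the quasi-BNS invariant
    IsOpen[QuasiBNS.sliceTopology G] (QuasiBNS.QSigma G) ∧
    -- approximate finite generation of the approximate kernel
    (∀ φ : QuasiBNS.Qh G, QuasiBNS.defect (φ : G → ℝ) ≠ 0 →
      (QuasiBNS.ApproxFinGen (QuasiBNS.Aker φ) ↔
        φ ∈ QuasiBNS.QSigma G ∧ -φ ∈ QuasiBNS.QSigma G)) ∧
    -- Novikov homology
    (∀ φ : QuasiBNS.Qh G, φ ≠ 0 →
      List.TFAE [
        φ ∈ QuasiBNS.QSigma G,
        ∃ U : Set (QuasiBNS.Qh G), IsOpen[QuasiBNS.sliceTopology G] U ∧ φ ∈ U ∧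
          ∀ ψ ∈ U, Subsingleton (QuasiBNS.novikovH1 ψ),
        Subsingleton (QuasiBNS.novikovH1 φ)]) := by
  obtain ⟨S, hS⟩ := QuasiBNS.exists_isSymmGen hG
  refine ⟨QuasiBNS.isOpen_QSigma hG, fun φ hD => QuasiBNS.approxFinGen_Aker_iff hG hD,
    fun φ hφ => ?_⟩
  tfae_have 1 → 2 := fun h => ⟨_, QuasiBNS.isOpen_QSigma hG, h, fun ψ hψ => by
    obtain ⟨T, hT⟩ := QuasiBNS.exists_pushes hS hψ (QuasiBNS.defect ψ.1)
    exact hT.novikovH1_subsingleton hS⟩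
  tfae_have 2 → 3 := fun ⟨_, _, hφU, hU⟩ => hU φ hφU
  tfae_have 3 → 1 := fun h => by
    obtain ⟨T, hT⟩ := QuasiBNS.exists_pushes_of_novikovH1_subsingleton hS hφ h
    exact QuasiBNS.mem_QSigma_of_pushes hG hS hT
  tfae_finish
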